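/- Let $k$ be a field and let $A$ be a connected DG $k$-algebra, i.e. a $\mathbb{Z}$-graded $k$-algebra with $A^i=0$ for $i<0$ and $A^0=k$, with a $k$-linear differential of degree $1$ satisfying the graded Leibniz rule. Let $A^{op}$ be the opposite DG algebra, with multiplication $a\cdot b=(-1)^{|a||b|}ba$, let $A^e=A\otimes_k A^{op}$ be the enveloping DG algebra, and regard $A$ as a DG $A^e$-module via $(a\otimes b)c=(-1)^{|b||c|}acb$. For a DG algebra $B$, a semi-free filtration of a DG $B$-module $F$ is a chain of DG submodules $0=F(-1)\subseteq F(0)\subseteq F(1)\subseteq\cdots$ with $F=\bigcup_n F(n)$ such that each $F(n)/F(n-1)$ is DG free (free over $B$ on a basis of homogeneous cocycles). It is strictly increasing if $F(i-1)\neq F(i)$ whenever $i\ge 0$ and $F(i-1)\neq F$, and it has length $n\ge 0$ if $n$ is the least natural number with $F(n)=F$ (length $+\infty$ if there is none; so the zero module has a filtration of length $0$). The DG free class of a semi-free $F$ is the infimum of the lengths of its strictly increasing semi-free filtrations. The cone length $\mathrm{cl}_B M\in\mathbb{N}\cup\{+\infty\}$ of a DG $B$-module $M$ is the infimum of the DG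 free classes of $F$ over all semi-free resolutions (quasi-isomorphisms) $F\to M$ with $F$ semi-free, and the left global dimension of $B$ is $l.\mathrm{Gl.dim}\,B=\sup_M \mathrm{cl}_B M$ over all DG $B$-modules $M$. If $\mathrm{cl}_{A^e}A<+\infty$, then $\mathrm{cl}_A M\le \mathrm{cl}_{A^e}A$ for every DG $A$-module $M$. Moreover $l.\mathrm{Gl.dim}\,A\le \mathrm{cl}_{A^e}A$. -/

import Mathlib

open DirectSum TensorProduct

universe u

noncomputable section

/-- A differential graded algebra over the field `k`: a `ℤ`-graded `k`-algebra with a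
`k`-linear differential of degree `1` which satisfies the graded Leibniz rule. -/
structure DGAlg (k : Type u) [Field k] : Type (u + 1) where
  carrier : Type u
  [ring : Ring carrier]
  [algebra : Algebra k carrier]
  gr : ℤ → Submodule k carrier
  [graded : GradedAlgebra gr]
  d : carrier →ₗ[k] carrier
  d_mem : ∀ (i : ℤ) (a : carrier), a ∈ gr i → d a ∈ gr (i + 1)
  d_d : ∀ a : carrier, d (d a) = 0
  leibniz : ∀ (i : ℤ) (a b : carrier), a ∈ gr i →
    d (a * b) = d a * b + i.negOnePow • (a * d b)

namespace DGAlg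

variable {k : Type u} [Field k]

instance : CoeSort (DGAlg k) (Type u) := ⟨DGAlg.carrier⟩

attribute [instance] DGAlg.ring DGAlg.algebra DGAlg.graded

/-- `A` is connected: `A^i = 0` for `i < 0` and `A^0 = k` (via the unit map `k → A`). -/
def IsConnected (A : DGAlg k) : Prop :=
  (∀ i : ℤ, i < 0 → A.gr i = ⊥) ∧
  Function.Injective (algebraMap k A) ∧
  (A.gr 0 : Set A) = Set.range (algebraMap k A)

end DGAlg

/-- A (left) differential graded module over the DG algebra `A`. -/
structure DGMod {k : Type u} [Field k] (A : DGAlg k) : Type (u + 1) where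
  carrier : Type u
  [addCommGroup : AddCommGroup carrier]
  [module : Module k carrier]
  [moduleA : Module A carrier]
  [tower : IsScalarTower k A carrier]
  gr : ℤ → Submodule k carrier
  [graded : DirectSum.Decomposition gr]
  smul_mem : ∀ (i j : ℤ) (a : A) (m : carrier), a ∈ A.gr i → m ∈ gr j → a • m ∈ gr (i + j)
  d : carrier →ₗ[k] carrier
  d_mem : ∀ (i : ℤ) (m : carrier), m ∈ gr i → d m ∈ gr (i + 1)
  d_d : ∀ m : carrier, d (d m) = 0
  leibniz : ∀ (i : ℤ) (a : A) (m : carrier), a ∈ A.gr i →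
    d (a • m) = A.d a • m + i.negOnePow • (a • d m)

namespace DGMod

variable {k : Type u} [Field k] {A : DGAlg k}

instance : CoeSort (DGMod A) (Type u) := ⟨DGMod.carrier⟩

attribute [instance] DGMod.addCommGroup DGMod.module DGMod.moduleA DGMod.tower DGMod.graded

/-- The cohomology `H(M) = ker d / im d`. -/
abbrev Cohomology (M : DGMod A) : Type u :=
  LinearMap.ker M.d ⧸ (LinearMap.range M.d).submoduleOf (LinearMap.ker M.d)

end DGMod

/-- Morphisms of DG modules: `A`-linear maps of degree `0` that commute with the
differentials. -/
structure DGHom {k : Type u} [Field k] {A : DGAlg k} (M N : DGMod A) where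
  toLin : M →ₗ[A] N
  map_mem : ∀ (i : ℤ) (m : M), m ∈ M.gr i → toLin m ∈ N.gr i
  comm : ∀ m : M, toLin (M.d m) = N.d (toLin m)

namespace DGHom

variable {k : Type u} [Field k] {A : DGAlg k} {M N : DGMod A}

/-- The map induced by a morphism on cocycles. -/
def onCocycles (f : DGHom M N) : LinearMap.ker M.d →ₗ[k] LinearMap.ker N.d :=
  (f.toLin.restrictScalars k).restrict fun m hm => by
    rw [LinearMap.mem_ker] at hm ⊢
    rw [LinearMap.restrictScalars_apply, ← f.comm, hm, map_zero]

/-- The map `H(f) : H(M) → H(N)` induced by a morphism `f`. -/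
def onCohomology (f : DGHom M N) : M.Cohomology →ₗ[k] N.Cohomology :=
  Submodule.mapQ _ _ f.onCocycles (by
    rintro ⟨x, hx⟩ ⟨y, hy⟩
    exact ⟨f.toLin y, by rw [← f.comm, hy]; rfl⟩)

/-- `f` is a quasi-isomorphism if `H(f)` is an isomorphism. -/
def IsQuasiIso (f : DGHom M N) : Prop := Function.Bijective f.onCohomology

end DGHom

/-- A DG submodule: an `A`-submodule that is graded and stable under the differential. -/
structure DGSubmodule {k : Type u} [Field k] {A : DGAlg k} (M : DGMod A) where
  toSub : Submodule A M
  homogeneous : ∀ (i : ℤ) (m : M), m ∈ toSub → (decompose M.gr m i : M) ∈ toSub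
  d_mem : ∀ m : M, m ∈ toSub → M.d m ∈ toSub

namespace DGSubmodule

variable {k : Type u} [Field k] {A : DGAlg k} {M : DGMod A}

/-- A decomposition from projections `π i : W → 𝒲 i`, of which almost all vanish on each
element and which together determine it. -/
@[reducible] def decompositionOf {V W : Type u} [AddCommGroup V] [Module k V] [AddCommGroup W] [Module k W]
    (𝒱 : ℤ → Submodule k V) [Decomposition 𝒱] (𝒲 : ℤ → Submodule k W)
    (π : (i : ℤ) → W →ₗ[k] 𝒲 i)
    (fin : ∀ w, ∃ v : V, ∀ i, decompose 𝒱 v i = 0 → π i w = 0)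
    (same : ∀ (i : ℤ) (w : 𝒲 i), π i w = w)
    (ne : ∀ (i j : ℤ) (w : 𝒲 i), j ≠ i → π j w = 0)
    (ext : ∀ w, (∀ i, π i w = 0) → w = 0) : Decomposition 𝒲 := by
  classical
  refine DirectSum.IsInternal.chooseDecomposition 𝒲 ?_
  have key : ∀ (x : ⨁ i, 𝒲 i) (i : ℤ), π i (DirectSum.coeAddMonoidHom 𝒲 x) = x i := by
    intro x i
    induction x using DirectSum.induction_on with
    | zero => simp
    | of j w =>
      rw [DirectSum.coeAddMonoidHom_of]
      by_cases h : i = j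
      · subst h; rw [same, DirectSum.of_eq_same]
      · rw [ne j i w h, DirectSum.of_eq_of_ne _ _ _ h]
    | add x y hx hy => rw [map_add, map_add, hx, hy]; rfl
  constructor
  · intro x y hxy
    apply DFinsupp.ext
    intro i
    rw [← key, ← key, hxy]
  · intro w
    obtain ⟨v, hv⟩ := fin w
    refine ⟨DFinsupp.mk (decompose 𝒱 v).support fun i => π i w, ?_⟩
    rw [← sub_eq_zero]
    apply ext
    intro i
    rw [map_sub, key, sub_eq_zero, DFinsupp.mk_apply]
    split_ifs with h
    · rfl
    · rw [hv i (by simpa using h)]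

/-- A DG submodule as a DG module. -/
def toDGMod (N : DGSubmodule M) : DGMod A where
  carrier := N.toSub
  gr i := (M.gr i).comap (N.toSub.subtype.restrictScalars k)
  graded := decompositionOf M.gr _
    (fun i =>
      { toFun := fun x => ⟨⟨decompose M.gr (x : M) i, N.homogeneous i x x.2⟩,
          (decompose M.gr (x : M) i).2⟩
        map_add' := fun x y => by ext; simp [decompose_add]
        map_smul' := fun c x => by
          ext
          exact congrArg (fun t => ((t i : M.gr i) : M)) (decompose_smul M.gr c (x : M)) })
    (fun w => ⟨w, fun i hi => by ext; simp [hi]⟩)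
    (fun i w => by
      ext
      exact decompose_of_mem_same _ w.2)
    (fun i j w h => by
      ext
      exact decompose_of_mem_ne _ w.2 h.symm)
    (fun w h => by
      have h0 : decompose M.gr (w : M) = 0 := by
        refine DFinsupp.ext fun i => Subtype.ext ?_
        have hi := congrArg Subtype.val (h i)
        have hj := congrArg (fun t : N.toSub => (t : M)) hi
        exact hj
      ext
      simpa using congrArg (decompose M.gr).symm h0)
  smul_mem i j a m ha hm := M.smul_mem i j a m ha hm
  d := (M.d).restrict (p := N.toSub.restrictScalars k) (q := N.toSub.restrictScalars k) N.d_mem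
  d_mem i m hm := M.d_mem i m hm
  d_d m := by ext; exact M.d_d m
  leibniz i a m ha := by ext; exact M.leibniz i a m ha

/-- The quotient of a DG module by a DG submodule. -/
def quotient (N : DGSubmodule M) : DGMod A where
  carrier := M ⧸ N.toSub
  gr i := (M.gr i).map (N.toSub.mkQ.restrictScalars k)
  graded := decompositionOf M.gr _
    (fun i => (N.toSub.restrictScalars k).liftQ
      (((N.toSub.mkQ.restrictScalars k).submoduleMap (M.gr i)) ∘ₗ
        (DirectSum.component k ℤ (fun i => M.gr i) i) ∘ₗ
          (decomposeLinearEquiv M.gr).toLinearMap) (by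
      intro m hm
      rw [LinearMap.mem_ker]
      ext
      exact (Submodule.Quotient.mk_eq_zero _).2 (N.homogeneous i m hm)))
    (fun w => by
      obtain ⟨m, rfl⟩ := N.toSub.mkQ_surjective w
      refine ⟨m, fun i hi => ?_⟩
      ext
      change N.toSub.mkQ (decompose M.gr m i : M) = 0
      rw [hi]; simp)
    (fun i w => by
      obtain ⟨_, m, hm, rfl⟩ := w
      ext
      change N.toSub.mkQ (decompose M.gr m i : M) = N.toSub.mkQ m
      rw [decompose_of_mem_same _ hm])
    (fun i j w h => by
      obtain ⟨_, m, hm, rfl⟩ := w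
      ext
      change N.toSub.mkQ (decompose M.gr m j : M) = 0
      rw [decompose_of_mem_ne _ hm h.symm, map_zero])
    (fun w h => by
      classical
      obtain ⟨m, rfl⟩ := N.toSub.mkQ_surjective w
      rw [← sum_support_decompose M.gr m, map_sum]
      exact Finset.sum_eq_zero fun i _ => congrArg Subtype.val (h i))
  smul_mem i j a m ha hm := by
    obtain ⟨m, hm, rfl⟩ := hm
    exact ⟨a • m, M.smul_mem i j a m ha hm, rfl⟩
  d := (N.toSub.restrictScalars k).mapQ (N.toSub.restrictScalars k) M.d N.d_mem
  d_mem i m hm := by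
    obtain ⟨m, hm, rfl⟩ := hm
    exact ⟨M.d m, M.d_mem i m hm, rfl⟩
  d_d m := by
    obtain ⟨m, rfl⟩ := N.toSub.mkQ_surjective m
    change N.toSub.mkQ (M.d (M.d m)) = 0
    rw [M.d_d, map_zero]
  leibniz i a m ha := by
    obtain ⟨m, rfl⟩ := N.toSub.mkQ_surjective m
    change N.toSub.mkQ (M.d (a • m)) = _
    rw [M.leibniz i a m ha]
    rfl

/-- The inclusion of a DG submodule. -/
def incl (N : DGSubmodule M) : N.toDGMod →ₗ[k] M := N.toSub.subtype.restrictScalars k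

lemma incl_decompose (N : DGSubmodule M) (i : ℤ) (x : N.toDGMod) :
    N.incl (decompose N.toDGMod.gr x i) = decompose M.gr (N.incl x) i := by
  induction x using Decomposition.inductionOn N.toDGMod.gr with
  | zero => simp
  | @homogeneous j x =>
    have hx : N.incl x ∈ M.gr j := x.2
    by_cases h : i = j
    · subst h
      rw [decompose_of_mem_same _ x.2, decompose_of_mem_same _ hx]
    · rw [decompose_of_mem_ne _ x.2 (Ne.symm h), decompose_of_mem_ne _ hx (Ne.symm h), map_zero]
  | add x y hx hy =>
    rw [decompose_add, map_add, decompose_add, DirectSum.add_apply, DirectSum.add_apply,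
      Submodule.coe_add, Submodule.coe_add, map_add, hx, hy]

/-- The intersection of `N'` with the DG submodule `N`, as a DG submodule of `N`. -/
def restrictTo (N' N : DGSubmodule M) : DGSubmodule N.toDGMod where
  toSub := N'.toSub.comap N.toSub.subtype
  homogeneous i m hm := by
    change N.incl (decompose N.toDGMod.gr m i) ∈ N'.toSub
    rw [incl_decompose]
    exact N'.homogeneous i _ hm
  d_mem m hm := N'.d_mem _ hm

/-- The subquotient `N / N'` of DG submodules `N' ≤ N`. -/
def subquotient (N' N : DGSubmodule M) : DGMod A := (N'.restrictTo N).quotient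

end DGSubmodule

namespace DGMod

variable {k : Type u} [Field k] {A : DGAlg k}

/-- `M` is DG free: `M ≅ ⨁_{y ∈ Y} A e_y` for a graded set `Y`, with `e_y` homogeneous and
`d e_y = 0`; that is, `M` is free over `A` on a basis of homogeneous cocycles. -/
def IsDGFree (M : DGMod A) : Prop :=
  ∃ (Y : Type u) (e : Module.Basis Y A M), ∀ y, (∃ i : ℤ, e y ∈ M.gr i) ∧ M.d (e y) = 0

/-- A semi-free filtration `0 = F(-1) ⊆ F(0) ⊆ F(1) ⊆ ⋯` of `F`, with `F = ⋃ F(n)` and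
DG free subquotients `F(n) / F(n-1)`. The index is shifted by one: `fil n` is `F(n-1)`. -/
structure SemiFreeFiltration (F : DGMod A) where
  fil : ℕ → DGSubmodule F
  bot : (fil 0).toSub = ⊥
  mono : ∀ n, (fil n).toSub ≤ (fil (n + 1)).toSub
  union : ∀ x : F, ∃ n, x ∈ (fil n).toSub
  free : ∀ n, ((fil n).subquotient (fil (n + 1))).IsDGFree

/-- A DG module is semi-free if it has a semi-free filtration. -/
def IsSemiFree (F : DGMod A) : Prop := Nonempty F.SemiFreeFiltration

namespace SemiFreeFiltration

variable {F : DGMod A}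

/-- Strictly increasing: `F(i-1) ≠ F(i)` whenever `F(i-1) ≠ F`, `i ≥ 0`. -/
def IsStrict (φ : F.SemiFreeFiltration) : Prop :=
  ∀ i : ℕ, (φ.fil i).toSub ≠ ⊤ → (φ.fil i).toSub ≠ (φ.fil (i + 1)).toSub

/-- The filtration has length `n`: `F(n) = F`, and `F(n-1) ≠ F` if `n ≥ 1`. (For `n = 0` the
condition `F(-1) ≠ F` is automatic if `F ≠ 0`; so `0` has the filtration of length `0`.) -/
def HasLength (φ : F.SemiFreeFiltration) (n : ℕ) : Prop :=
  (φ.fil (n + 1)).toSub = ⊤ ∧ (n ≠ 0 → (φ.fil n).toSub ≠ ⊤)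

end SemiFreeFiltration

/-- The DG free class: the infimum of the lengths of all strictly increasing semi-free
filtrations, `⊤` if there is none of finite length. -/
def dgFreeClass (F : DGMod A) : ℕ∞ :=
  ⨅ (n : ℕ) (_ : ∃ φ : F.SemiFreeFiltration, φ.IsStrict ∧ φ.HasLength n), (n : ℕ∞)

/-- The cone length `cl_A M`: the infimum of the DG free classes of all semi-free
resolutions `F → M`. -/
def coneLength (M : DGMod A) : ℕ∞ :=
  ⨅ (F : DGMod A) (_ : F.IsSemiFree) (_ : ∃ f : DGHom F M, f.IsQuasiIso), F.dgFreeClass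

end DGMod

namespace DGAlg

variable {k : Type u} [Field k]

/-- The left global dimension: the supremum of the cone lengths of all DG `A`-modules. -/
def leftGlobalDim (A : DGAlg k) : ℕ∞ := ⨆ M : DGMod A, M.coneLength

/-! ### The opposite DG algebra -/

/-- Underlying space of the opposite DG algebra. -/
def OpCarrier (A : DGAlg k) : Type u := A.carrier

instance (A : DGAlg k) : AddCommGroup A.OpCarrier := inferInstanceAs (AddCommGroup A.carrier)
instance (A : DGAlg k) : Module k A.OpCarrier := inferInstanceAs (Module k A.carrier)

/-- The opposite multiplication `a ⬝ b = (-1)^(|a||b|) b a`: the multiplication after the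
signed flip of the two factors. -/
def opMul (A : DGAlg k) : A →ₗ[k] A →ₗ[k] A :=
  TensorProduct.curry (LinearMap.mul' k A ∘ₗ
    (GradedTensorProduct.of k A.gr A.gr).symm.toLinearMap ∘ₗ
      (GradedTensorProduct.comm A.gr A.gr).toLinearMap ∘ₗ
        (GradedTensorProduct.of k A.gr A.gr).toLinearMap)

lemma map_sign {V W : Type*} [AddCommGroup V] [Module k V] [AddCommGroup W] [Module k W]
    (f : V →ₗ[k] W) (i : ℤ) (v : V) : f (i.negOnePow • v) = i.negOnePow • f v := by
  rcases Int.units_eq_one_or i.negOnePow with h | h <;> rw [h] <;> simp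

lemma sign_mem {V : Type*} [AddCommGroup V] [Module k V] (p : Submodule k V) (i : ℤ) {v : V}
    (hv : v ∈ p) : i.negOnePow • v ∈ p := by
  rcases Int.units_eq_one_or i.negOnePow with h | h <;> rw [h] <;> simpa using hv

lemma opMul_apply (A : DGAlg k) {i j : ℤ} {a b : A} (ha : a ∈ A.gr i) (hb : b ∈ A.gr j) :
    A.opMul a b = (i * j).negOnePow • (b * a) := by
  have := GradedTensorProduct.comm_coe_tmul_coe (R := k) A.gr A.gr (⟨a, ha⟩ : A.gr i)
    (⟨b, hb⟩ : A.gr j)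
  change LinearMap.mul' k A ((GradedTensorProduct.of k A.gr A.gr).symm
    (GradedTensorProduct.comm A.gr A.gr (GradedTensorProduct.tmul k a b))) = _
  rw [this, mul_comm i j]
  change ((LinearMap.mul' k A) ∘ₗ (GradedTensorProduct.of k A.gr A.gr).symm.toLinearMap)
    ((j * i).negOnePow • GradedTensorProduct.tmul k b a) = _
  rw [map_sign]
  rfl

lemma hom_ext (A : DGAlg k) {W : Type*} [AddCommGroup W] [Module k W] {f g : A →ₗ[k] W}
    (h : ∀ i, ∀ a ∈ A.gr i, f a = g a) : f = g :=
  DirectSum.decompose_lhom_ext A.gr fun i => by ext a; exact h i a a.2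

lemma opMul_mem (A : DGAlg k) {i j : ℤ} {a b : A} (ha : a ∈ A.gr i) (hb : b ∈ A.gr j) :
    A.opMul a b ∈ A.gr (i + j) := by
  rw [opMul_apply A ha hb, add_comm]
  exact sign_mem _ _ (SetLike.mul_mem_graded hb ha)

lemma one_opMul (A : DGAlg k) (a : A) : A.opMul 1 a = a := by
  refine LinearMap.congr_fun (f := A.opMul 1) (g := LinearMap.id) (A.hom_ext fun i a ha => ?_) a
  rw [opMul_apply A (SetLike.one_mem_graded A.gr) ha]
  simp

lemma opMul_one (A : DGAlg k) (a : A) : A.opMul a 1 = a := by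
  refine LinearMap.congr_fun (f := A.opMul.flip 1) (g := LinearMap.id)
    (A.hom_ext fun i a ha => ?_) a
  rw [LinearMap.flip_apply, opMul_apply A ha (SetLike.one_mem_graded A.gr)]
  simp

lemma sign_mul_left (A : DGAlg k) (i : ℤ) (a b : A) :
    (i.negOnePow • a) * b = i.negOnePow • (a * b) := by
  rcases Int.units_eq_one_or i.negOnePow with h | h <;> rw [h] <;> simp

lemma sign_mul_right (A : DGAlg k) (i : ℤ) (a b : A) :
    a * (i.negOnePow • b) = i.negOnePow • (a * b) := by
  rcases Int.units_eq_one_or i.negOnePow with h | h <;> rw [h] <;> simp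

lemma opMul_assoc (A : DGAlg k) (a b c : A) :
    A.opMul (A.opMul a b) c = A.opMul a (A.opMul b c) := by
  induction a using Decomposition.inductionOn A.gr with
  | zero => simp
  | add a a' h h' => simp only [map_add, LinearMap.add_apply, h, h']
  | @homogeneous i a =>
  induction b using Decomposition.inductionOn A.gr with
  | zero => simp
  | add a a' h h' => simp only [map_add, LinearMap.add_apply, h, h']
  | @homogeneous j b =>
  induction c using Decomposition.inductionOn A.gr with
  | zero => simp
  | add a a' h h' => simp only [map_add, h, h']
  | @homogeneous l c =>
  rw [opMul_apply A (opMul_mem A a.2 b.2) c.2, opMul_apply A a.2 (opMul_mem A b.2 c.2),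
    opMul_apply A a.2 b.2, opMul_apply A b.2 c.2, sign_mul_left, sign_mul_right, smul_smul,
    smul_smul, mul_assoc, ← Int.negOnePow_add, ← Int.negOnePow_add]
  congr 2
  ring

instance (A : DGAlg k) : Ring A.OpCarrier :=
  { (inferInstance : AddCommGroup A.OpCarrier) with
    mul := fun a b => A.opMul a b
    one := (1 : A.carrier)
    mul_assoc := A.opMul_assoc
    one_mul := A.one_opMul
    mul_one := A.opMul_one
    left_distrib := fun a b c => map_add (A.opMul a) b c
    right_distrib := fun a b c => LinearMap.map_add₂ A.opMul a b c
    zero_mul := fun a => LinearMap.map_zero₂ A.opMul a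
    mul_zero := fun a => map_zero (A.opMul a) }

instance (A : DGAlg k) : Algebra k A.OpCarrier :=
  Algebra.ofModule (fun r x y => LinearMap.map_smul₂ A.opMul r x y)
    (fun r x y => map_smul (A.opMul x) r y)

lemma opMul_leibniz (A : DGAlg k) {i : ℤ} {a : A} (ha : a ∈ A.gr i) (b : A) :
    A.d (A.opMul a b) = A.opMul (A.d a) b + i.negOnePow • A.opMul a (A.d b) := by
  induction b using Decomposition.inductionOn A.gr with
  | zero => simp
  | add b b' h h' => simp only [map_add, h, h', smul_add]; abel
  | @homogeneous j b =>
  rw [opMul_apply A ha b.2, opMul_apply A (A.d_mem i a ha) b.2,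
    opMul_apply A ha (A.d_mem j b b.2), map_sign, A.leibniz j b a b.2, smul_add, smul_smul,
    smul_smul, ← Int.negOnePow_add, ← Int.negOnePow_add, add_comm]
  congr 2
  · congr 1; ring
  · rw [show i + i * (j + 1) = i * j + 2 * i by ring, Int.negOnePow_add _ (2 * i),
      Int.negOnePow_two_mul, mul_one]

/-- The opposite DG algebra `A^op`, with `a ⬝ b = (-1)^(|a||b|) b a` and the differential
of `A`. -/
def op (A : DGAlg k) : DGAlg k where
  carrier := A.OpCarrier
  gr := A.gr
  graded :=
    { one_mem := SetLike.one_mem_graded A.gr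
      mul_mem := fun _ _ _ _ ha hb => A.opMul_mem ha hb
      toDecomposition := A.graded.toDecomposition }
  d := A.d
  d_mem := A.d_mem
  d_d := A.d_d
  leibniz _ _ b ha := A.opMul_leibniz ha b

/-- The identity map of the underlying spaces, from `A` to `A^op`. -/
def toOp (A : DGAlg k) : A ≃ₗ[k] A.op :=
  { toFun := fun a => a
    invFun := fun a => a
    map_add' := fun _ _ => rfl
    map_smul' := fun _ _ => rfl
    left_inv := fun _ => rfl
    right_inv := fun _ => rfl }

lemma toOp_mul (A : DGAlg k) {i j : ℤ} {a b : A} (ha : a ∈ A.gr i) (hb : b ∈ A.gr j) :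
    A.toOp a * A.toOp b = (i * j).negOnePow • A.toOp (b * a) :=
  opMul_apply A ha hb

/-! ### The tensor product of DG algebras -/

/-- The sign involution `a ↦ (-1)^|a| a`. -/
def sgn (A : DGAlg k) : A →ₗ[k] A :=
  DirectSum.toModule k ℤ A (fun i => ((i.negOnePow : ℤ) : k) • (A.gr i).subtype) ∘ₗ
    (decomposeLinearEquiv A.gr).toLinearMap

lemma sgn_apply (A : DGAlg k) {i : ℤ} {a : A} (ha : a ∈ A.gr i) :
    A.sgn a = i.negOnePow • a := by
  lift a to A.gr i using ha
  simp only [sgn, LinearMap.comp_apply, LinearEquiv.coe_coe, decomposeLinearEquiv_apply_coe]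
  rw [DirectSum.toModule_lof]
  rcases Int.units_eq_one_or i.negOnePow with h | h <;> rw [h] <;> simp

/-- The underlying algebra of `A ⊗ B`, with `(a ⊗ b)(a' ⊗ b') = (-1)^(|b||a'|) aa' ⊗ bb'`. -/
abbrev TensorCarrier (A B : DGAlg k) : Type u := GradedTensorProduct k A.gr B.gr

variable {A B : DGAlg k}

/-- The homogeneous tensors of degree `n`. -/
def tensorGr (A B : DGAlg k) (n : ℤ) : Submodule k (TensorCarrier A B) :=
  Submodule.span k {x | ∃ (i j : ℤ) (a : A) (b : B), a ∈ A.gr i ∧ b ∈ B.gr j ∧ i + j = n ∧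
    x = GradedTensorProduct.tmul k a b}

lemma tmul_mem {i j n : ℤ} {a : A} {b : B} (ha : a ∈ A.gr i) (hb : b ∈ B.gr j)
    (h : i + j = n) : (GradedTensorProduct.tmul k a b : TensorCarrier A B) ∈ tensorGr A B n :=
  Submodule.subset_span ⟨i, j, a, b, ha, hb, h, rfl⟩

lemma tensor_induction {p : TensorCarrier A B → Prop} (x : TensorCarrier A B) (zero : p 0)
    (add : ∀ x y, p x → p y → p (x + y))
    (tmul : ∀ (i j : ℤ) (a : A) (b : B), a ∈ A.gr i → b ∈ B.gr j →
      p (GradedTensorProduct.tmul k a b)) : p x := by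
  induction x using TensorProduct.induction_on with
  | zero => exact zero
  | add x y hx hy => exact add x y hx hy
  | tmul a b =>
  change p (GradedTensorProduct.tmul k a b)
  induction a using Decomposition.inductionOn A.gr with
  | zero => rw [GradedTensorProduct.tmul, TensorProduct.zero_tmul]; exact zero
  | add a a' h h' =>
    rw [GradedTensorProduct.tmul, TensorProduct.add_tmul]; exact add _ _ h h'
  | @homogeneous i a =>
  induction b using Decomposition.inductionOn B.gr with
  | zero => rw [GradedTensorProduct.tmul, TensorProduct.tmul_zero]; exact zero
  | add b b' h h' =>
    rw [GradedTensorProduct.tmul, TensorProduct.tmul_add]; exact add _ _ h h'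
  | @homogeneous j b => exact tmul i j a b a.2 b.2

lemma mul_tmul {j i' : ℤ} (a : A) {b : B} {a' : A} (b' : B) (hb : b ∈ B.gr j)
    (ha' : a' ∈ A.gr i') :
    (GradedTensorProduct.tmul k a b * GradedTensorProduct.tmul k a' b' : TensorCarrier A B) =
      (j * i').negOnePow • GradedTensorProduct.tmul k (a * a') (b * b') :=
  GradedTensorProduct.tmul_coe_mul_coe_tmul A.gr B.gr a ⟨b, hb⟩ ⟨a', ha'⟩ b'

lemma tensor_smul_mul (c : k) (x y : TensorCarrier A B) : (c • x) * y = c • (x * y) :=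
  LinearMap.map_smul₂ (GradedTensorProduct.mulHom A.gr B.gr) c x y

lemma tensor_mul_smul (c : k) (x y : TensorCarrier A B) : x * (c • y) = c • (x * y) :=
  map_smul (GradedTensorProduct.mulHom A.gr B.gr x) c y

lemma tensor_sign_mul (i : ℤ) (x y : TensorCarrier A B) :
    (i.negOnePow • x) * y = i.negOnePow • (x * y) :=
  map_sign ((GradedTensorProduct.mulHom A.gr B.gr).flip y) i x

lemma tensor_mul_sign (i : ℤ) (x y : TensorCarrier A B) :
    x * (i.negOnePow • y) = i.negOnePow • (x * y) :=
  map_sign (GradedTensorProduct.mulHom A.gr B.gr x) i y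

instance : SetLike.GradedMonoid (tensorGr A B) where
  one_mem := tmul_mem (SetLike.one_mem_graded A.gr) (SetLike.one_mem_graded B.gr) (add_zero 0)
  mul_mem m n x y hx hy := by
    induction hx using Submodule.span_induction with
    | zero => rw [zero_mul]; exact zero_mem _
    | add x x' _ _ h h' => rw [add_mul]; exact add_mem h h'
    | smul c x _ h => rw [tensor_smul_mul]; exact Submodule.smul_mem _ _ h
    | mem x hx =>
    obtain ⟨i, j, a, b, ha, hb, rfl, rfl⟩ := hx
    induction hy using Submodule.span_induction with
    | zero => rw [mul_zero]; exact zero_mem _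
    | add x x' _ _ h h' => rw [mul_add]; exact add_mem h h'
    | smul c x _ h => rw [tensor_mul_smul]; exact Submodule.smul_mem _ _ h
    | mem y hy =>
    obtain ⟨i', j', a', b', ha', hb', rfl, rfl⟩ := hy
    rw [mul_tmul a b' hb ha']
    exact sign_mem _ _ (tmul_mem (SetLike.mul_mem_graded ha ha')
      (SetLike.mul_mem_graded hb hb') (by ring))

/-- The map `A ⊗ B → ⨁ (A ⊗ B)^n` that splits a tensor into its homogeneous components. -/
def tensorSplit (A B : DGAlg k) : TensorCarrier A B →ₗ[k] ⨁ n, tensorGr A B n :=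
  TensorProduct.lift
    (((DirectSum.toModule k ℤ ((⨁ j, B.gr j) →ₗ[k] ⨁ n, tensorGr A B n) fun i =>
      LinearMap.flip (DirectSum.toModule k ℤ (A.gr i →ₗ[k] ⨁ n, tensorGr A B n) fun j =>
        LinearMap.flip (LinearMap.mk₂ k
          (fun (a : A.gr i) (b : B.gr j) => DirectSum.lof k ℤ (fun n => tensorGr A B n) (i + j)
            ⟨GradedTensorProduct.tmul k (a : A) (b : B), tmul_mem a.2 b.2 rfl⟩)
          (fun a a' b => by
            rw [← map_add]; congr 1; ext
            exact TensorProduct.add_tmul _ _ _)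
          (fun c a b => by
            rw [← map_smul]; congr 1)
          (fun a b b' => by
            rw [← map_add]; congr 1; ext
            exact TensorProduct.tmul_add _ _ _)
          (fun c a b => by
            rw [← map_smul]; congr 1; ext
            exact TensorProduct.tmul_smul _ _ _))))).compl₁₂
      (decomposeLinearEquiv A.gr).toLinearMap (decomposeLinearEquiv B.gr).toLinearMap) ∘ₗ
    (GradedTensorProduct.of k A.gr B.gr).symm.toLinearMap

lemma tensorSplit_tmul {i j n : ℤ} {a : A} {b : B} (ha : a ∈ A.gr i) (hb : b ∈ B.gr j)
    (h : i + j = n) : tensorSplit A B (GradedTensorProduct.tmul k a b) =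
      DirectSum.lof k ℤ (fun n => tensorGr A B n) n
        ⟨GradedTensorProduct.tmul k a b, tmul_mem ha hb h⟩ := by
  subst h
  lift a to A.gr i using ha
  lift b to B.gr j using hb
  simp only [tensorSplit, LinearMap.comp_apply, LinearEquiv.coe_coe,
    GradedTensorProduct.of_symm_of, TensorProduct.lift.tmul, LinearMap.compl₁₂_apply,
    decomposeLinearEquiv_apply_coe, DirectSum.toModule_lof, LinearMap.flip_apply,
    LinearMap.mk₂_apply]

instance : GradedAlgebra (tensorGr A B) where
  toDecomposition := Decomposition.ofLinearMap _ (tensorSplit A B)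
    (by
      refine LinearMap.ext fun x => ?_
      induction x using tensor_induction with
      | zero => simp
      | add x y hx hy => rw [map_add, map_add, hx, hy]
      | tmul i j a b ha hb =>
        rw [LinearMap.comp_apply, tensorSplit_tmul ha hb rfl, DirectSum.coeLinearMap_lof]
        rfl)
    (by
      ext n x : 2
      obtain ⟨x, hx⟩ := x
      simp only [LinearMap.comp_apply, DirectSum.coeLinearMap_lof, LinearMap.id_apply]
      induction hx using Submodule.span_induction with
      | zero => rw [map_zero]; exact (map_zero _).symm
      | add x y hx hy h h' => rw [map_add, h, h', ← map_add]; rfl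
      | smul c x hx h => rw [map_smul, h, ← map_smul]; rfl
      | mem x hx =>
        obtain ⟨i, j, a, b, ha, hb, h, rfl⟩ := hx
        exact tensorSplit_tmul ha hb h)

/-- The differential `d(a ⊗ b) = da ⊗ b + (-1)^|a| a ⊗ db`. -/
def tensorD (A B : DGAlg k) : TensorCarrier A B →ₗ[k] TensorCarrier A B :=
  (GradedTensorProduct.of k A.gr B.gr).toLinearMap ∘ₗ
    (TensorProduct.map A.d LinearMap.id + TensorProduct.map A.sgn B.d) ∘ₗ
      (GradedTensorProduct.of k A.gr B.gr).symm.toLinearMap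

lemma sign_tmul (i : ℤ) (a : A) (b : B) :
    (GradedTensorProduct.tmul k (i.negOnePow • a) b : TensorCarrier A B) =
      i.negOnePow • GradedTensorProduct.tmul k a b := by
  rcases Int.units_eq_one_or i.negOnePow with h | h <;> rw [h] <;>
    simp [GradedTensorProduct.tmul, TensorProduct.neg_tmul]

lemma tmul_sign (i : ℤ) (a : A) (b : B) :
    (GradedTensorProduct.tmul k a (i.negOnePow • b) : TensorCarrier A B) =
      i.negOnePow • GradedTensorProduct.tmul k a b := by
  rcases Int.units_eq_one_or i.negOnePow with h | h <;> rw [h] <;>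
    simp [GradedTensorProduct.tmul, TensorProduct.tmul_neg]

lemma tensorD_tmul {i : ℤ} {a : A} (b : B) (ha : a ∈ A.gr i) :
    tensorD A B (GradedTensorProduct.tmul k a b) = GradedTensorProduct.tmul k (A.d a) b +
      i.negOnePow • GradedTensorProduct.tmul k a (B.d b) := by
  have : tensorD A B (GradedTensorProduct.tmul k a b) = GradedTensorProduct.tmul k (A.d a) b +
    GradedTensorProduct.tmul k (A.sgn a) (B.d b) := rfl
  rw [this, sgn_apply A ha, sign_tmul]

lemma add_tmul' (a a' : A) (b : B) : (GradedTensorProduct.tmul k (a + a') b : TensorCarrier A B) =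
    GradedTensorProduct.tmul k a b + GradedTensorProduct.tmul k a' b :=
  TensorProduct.add_tmul _ _ _

lemma tmul_add' (a : A) (b b' : B) : (GradedTensorProduct.tmul k a (b + b') : TensorCarrier A B) =
    GradedTensorProduct.tmul k a b + GradedTensorProduct.tmul k a b' :=
  TensorProduct.tmul_add _ _ _

lemma tensor_leibniz {i j : ℤ} {a : A} {b : B} (ha : a ∈ A.gr i) (hb : b ∈ B.gr j)
    (y : TensorCarrier A B) :
    tensorD A B (GradedTensorProduct.tmul k a b * y) =
      tensorD A B (GradedTensorProduct.tmul k a b) * y +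
        (i + j).negOnePow • (GradedTensorProduct.tmul k a b * tensorD A B y) := by
  induction y using tensor_induction with
  | zero => simp
  | add y y' h h' => rw [mul_add, map_add, h, h', mul_add, map_add, mul_add, smul_add]; abel
  | tmul i' j' a' b' ha' hb' =>
  rw [mul_tmul a b' hb ha', map_sign, tensorD_tmul (b * b') (SetLike.mul_mem_graded ha ha'),
    tensorD_tmul b ha, tensorD_tmul b' ha', A.leibniz i a a' ha, B.leibniz j b b' hb,
    add_mul, mul_add, mul_tmul _ _ hb ha', mul_tmul _ _ hb (A.d_mem _ _ ha'),
    add_tmul', tmul_add', sign_tmul, tmul_sign]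
  have h1 : (i.negOnePow • GradedTensorProduct.tmul k a (B.d b) *
      GradedTensorProduct.tmul k a' b' : TensorCarrier A B) =
      (i + (j + 1) * i').negOnePow • GradedTensorProduct.tmul k (a * a') (B.d b * b') := by
    have := mul_tmul a b' (B.d_mem _ _ hb) ha'
    rw [Int.negOnePow_add, mul_smul, ← this, tensor_sign_mul]
  have h2 : (GradedTensorProduct.tmul k a b * i'.negOnePow •
      GradedTensorProduct.tmul k a' (B.d b') : TensorCarrier A B) =
      (i' + j * i').negOnePow • GradedTensorProduct.tmul k (a * a') (b * B.d b') := by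
    have := mul_tmul a (B.d b') hb ha'
    rw [Int.negOnePow_add, mul_smul, ← this, tensor_mul_sign]
  rw [h1, h2]
  simp only [smul_add, smul_smul, ← Int.negOnePow_add, mul_add, add_mul, mul_one, one_mul]
  simp only [Int.negOnePow_add]
  rcases Int.units_eq_one_or i.negOnePow with h | h <;>
  rcases Int.units_eq_one_or j.negOnePow with h' | h' <;>
  rcases Int.units_eq_one_or i'.negOnePow with h'' | h'' <;>
  rw [h, h', h''] <;> simp <;> abel

/-- The tensor product of two DG algebras. -/
def tensor (A B : DGAlg k) : DGAlg k where
  carrier := TensorCarrier A B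
  gr := tensorGr A B
  d := tensorD A B
  d_mem n x hx := by
    induction hx using Submodule.span_induction with
    | zero => rw [map_zero]; exact zero_mem _
    | add x y hx hy h h' => rw [map_add]; exact add_mem h h'
    | smul c x hx h => rw [map_smul]; exact Submodule.smul_mem _ _ h
    | mem x hx =>
      obtain ⟨i, j, a, b, ha, hb, rfl, rfl⟩ := hx
      rw [tensorD_tmul b ha]
      exact add_mem (tmul_mem (A.d_mem _ _ ha) hb (by ring))
        (sign_mem _ _ (tmul_mem ha (B.d_mem _ _ hb) (by ring)))
  d_d x := by
    induction x using tensor_induction with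
    | zero => simp
    | add x y h h' => rw [map_add, map_add, h, h', add_zero]
    | tmul i j a b ha hb =>
      rw [tensorD_tmul b ha, map_add, map_sign, tensorD_tmul _ ha,
        tensorD_tmul _ (A.d_mem _ _ ha), A.d_d, B.d_d, Int.negOnePow_succ]
      simp [GradedTensorProduct.tmul]
  leibniz n x y hx := by
    induction hx using Submodule.span_induction with
    | zero => simp
    | add x x' _ _ h h' => rw [add_mul, map_add, h, h', map_add, add_mul, add_mul, smul_add]; abel
    | smul c x _ h =>
      rw [tensor_smul_mul, map_smul, h, map_smul, tensor_smul_mul, tensor_smul_mul, smul_add,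
        smul_comm c]
    | mem x hx =>
      obtain ⟨i, j, a, b, ha, hb, rfl, rfl⟩ := hx
      exact tensor_leibniz ha hb y

/-! ### The enveloping DG algebra -/

/-- The enveloping DG algebra `A^e = A ⊗ A^op`. -/
def env (A : DGAlg k) : DGAlg k := A.tensor A.op

/-- The multiplication of `A^op`, as an action of `A^op` on the space `A`. -/
def opAct (A : DGAlg k) : A.op →ₐ[k] Module.End k A :=
  AlgHom.ofLinearMap (A.opMul ∘ₗ A.toOp.symm.toLinearMap)
    (LinearMap.ext fun a => A.one_opMul a)
    (fun a b => LinearMap.ext fun c => A.opMul_assoc a b c)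

lemma opAct_apply (A : DGAlg k) {j l : ℤ} {b c : A} (hb : b ∈ A.gr j) (hc : c ∈ A.gr l) :
    A.opAct (A.toOp b) c = (j * l).negOnePow • (c * b) :=
  opMul_apply A hb hc

/-- The algebra map `A^e → End_k(A)` that sends `a ⊗ b` to `c ↦ a (b ⬝ c)`, where `⬝` is the
multiplication of `A^op`; so `(a ⊗ b) c = (-1)^(|b||c|) a c b`. -/
def envAct (A : DGAlg k) : TensorCarrier A A.op →ₐ[k] Module.End k A :=
  GradedTensorProduct.lift A.gr A.op.gr (Algebra.lmul k A) A.opAct (by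
    rintro i j ⟨a, ha⟩ ⟨b, hb⟩
    have key : ∀ (b : A) (_ : b ∈ A.gr j) (c : A), a * A.opAct (A.toOp b) c =
        (j * i).negOnePow • A.opAct (A.toOp b) (a * c) := by
      intro b hb c
      induction c using Decomposition.inductionOn A.gr with
      | zero => simp
      | add c c' h h' => simp only [map_add, mul_add, h, h', smul_add]
      | @homogeneous l c =>
        rw [opAct_apply A hb c.2, opAct_apply A hb (SetLike.mul_mem_graded ha c.2),
          sign_mul_right, smul_smul, ← Int.negOnePow_add, ← mul_assoc]
        congr 1
        rw [show j * i + j * (i + l) = j * l + 2 * (j * i) by ring, Int.negOnePow_add _ (2 * _),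
          Int.negOnePow_two_mul, mul_one]
    refine LinearMap.ext fun c => (key b hb c).trans ?_
    rcases Int.units_eq_one_or (j * i).negOnePow with h | h
    · have h' : (-1 : ℤˣ) ^ (j * i) = 1 := h
      rw [h, h', one_smul, one_smul]; rfl
    · have h' : (-1 : ℤˣ) ^ (j * i) = -1 := h
      rw [h, h', Units.neg_smul, Units.neg_smul, one_smul, one_smul]; rfl)

lemma envAct_tmul (A : DGAlg k) {j l : ℤ} (a : A) {b c : A} (hb : b ∈ A.gr j)
    (hc : c ∈ A.gr l) : A.envAct (GradedTensorProduct.tmul k a (A.toOp b)) c =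
      (j * l).negOnePow • (a * c * b) := by
  change a * A.opAct (A.toOp b) c = _
  rw [opAct_apply A hb hc, sign_mul_right, mul_assoc]

lemma envAct_mem (A : DGAlg k) {i j : ℤ} {x : TensorCarrier A A.op} {m : A}
    (hx : x ∈ tensorGr A A.op i) (hm : m ∈ A.gr j) : A.envAct x m ∈ A.gr (i + j) := by
  induction hx using Submodule.span_induction with
  | zero => rw [map_zero]; exact zero_mem _
  | add x y _ _ h h' => rw [map_add]; exact add_mem h h'
  | smul c x _ h => rw [AlgHom.map_smul_of_tower]; exact Submodule.smul_mem _ _ h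
  | mem x hx =>
    obtain ⟨i, l, a, b, ha, hb, rfl, rfl⟩ := hx
    have := envAct_tmul A a (b := A.toOp.symm b) hb hm
    rw [LinearEquiv.apply_symm_apply] at this
    rw [this, show i + l + j = i + j + l by ring]
    exact sign_mem _ _ (SetLike.mul_mem_graded (SetLike.mul_mem_graded ha hm) hb)

lemma envAct_sign (A : DGAlg k) (i : ℤ) (x : TensorCarrier A A.op) (m : A) :
    A.envAct (i.negOnePow • x) m = i.negOnePow • A.envAct x m := by
  rcases Int.units_eq_one_or i.negOnePow with h | h <;> rw [h] <;> simp

lemma envAct_leibniz_tmul (A : DGAlg k) {i j l : ℤ} {a b m : A} (ha : a ∈ A.gr i)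
    (hb : b ∈ A.gr j) (hm : m ∈ A.gr l) :
    A.d (A.envAct (GradedTensorProduct.tmul k a (A.toOp b)) m) =
      A.envAct (tensorD A A.op (GradedTensorProduct.tmul k a (A.toOp b))) m +
        (i + j).negOnePow • A.envAct (GradedTensorProduct.tmul k a (A.toOp b)) (A.d m) := by
  have hd : A.op.d (A.toOp b) = A.toOp (A.d b) := rfl
  rw [tensorD_tmul _ ha, hd, map_add, LinearMap.add_apply, envAct_sign, envAct_tmul A a hb hm,
    envAct_tmul A _ hb hm, envAct_tmul A a hb (A.d_mem _ _ hm),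
    envAct_tmul A a (A.d_mem _ _ hb) hm, map_sign,
    A.leibniz (i + l) (a * m) b (SetLike.mul_mem_graded ha hm), A.leibniz i a m ha,
    add_mul, sign_mul_left]
  simp only [mul_add, add_mul, mul_one, one_mul, Int.negOnePow_add, smul_add, smul_smul]
  rcases Int.units_eq_one_or i.negOnePow with h | h <;>
  rcases Int.units_eq_one_or j.negOnePow with h' | h' <;>
  rcases Int.units_eq_one_or l.negOnePow with h'' | h'' <;>
  rw [h, h', h''] <;> simp <;> abel

lemma envAct_leibniz (A : DGAlg k) {n : ℤ} {x : TensorCarrier A A.op}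
    (hx : x ∈ tensorGr A A.op n) (m : A) :
    A.d (A.envAct x m) = A.envAct (tensorD A A.op x) m + n.negOnePow • A.envAct x (A.d m) := by
  induction hx using Submodule.span_induction with
  | zero => simp
  | add x y _ _ h h' =>
    rw [map_add, map_add, map_add, LinearMap.add_apply, LinearMap.add_apply,
      LinearMap.add_apply, map_add, h, h', smul_add]; abel
  | smul c x _ h =>
    rw [map_smul (tensorD A A.op), AlgHom.map_smul_of_tower, AlgHom.map_smul_of_tower,
      LinearMap.smul_apply, LinearMap.smul_apply, LinearMap.smul_apply, map_smul, h, smul_add,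
      smul_comm c]
  | mem x hx =>
    obtain ⟨i, j, a, b, ha, hb, rfl, rfl⟩ := hx
    induction m using Decomposition.inductionOn A.gr with
    | zero => simp
    | add m m' h h' => simp only [map_add, h, h', smul_add]; abel
    | homogeneous m => exact envAct_leibniz_tmul A (b := A.toOp.symm b) ha hb m.2

/-- `A` as a (left) DG module over `A^e`, with `(a ⊗ b) c = (-1)^(|b||c|) a c b`. -/
def selfEnv (A : DGAlg k) : DGMod A.env :=
  letI : Module A.env A.carrier := Module.compHom A.carrier A.envAct.toRingHom
  { carrier := A.carrier
    tower := ⟨fun c x m => by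
      change A.envAct (c • (show TensorCarrier A A.op from x)) m =
        c • A.envAct (show TensorCarrier A A.op from x) m
      rw [AlgHom.map_smul_of_tower, LinearMap.smul_apply]⟩
    gr := A.gr
    smul_mem := fun i j x m hx hm => A.envAct_mem hx hm
    d := A.d
    d_mem := A.d_mem
    d_d := A.d_d
    leibniz := fun n x m hx => A.envAct_leibniz hx m }

end DGAlg

end

/-! Let `F → A` be a semi-free resolution over `A^e` with a filtration of length `n`, and let `M` be
a DG `A`-module. The candidate for a resolution of `M` is `F ⊗_A M`. Two facts are needed: that `F
⊗_A M → M` is a quasi-isomorphism, and that `F ⊗_A M` is, up to quasi-isomorphism, semi-free over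
`A` with the levels `0, …, n`.

For the first fact, regard `F` as a bimodule with augmentation `ε : F → A`. Since `A^{-1} = 0`,
there is a cocycle `s` of degree `0` with `ε s = 1` exactly, so `a ↦ s a` is a right linear section
of `ε` and `π f = f - s ε(f)` is a projection onto the acyclic kernel of `ε`. This kernel is
contractible over the field `k`. As `F` is semi-free, the `k`-linear contraction can be improved,
level by level, to a right `A`-linear homotopy `h` with `d h + h d = π` (`exists_homotopy`). Right
linearity lets `h` pass to `F ⊗_A M`, where it shows that `m ↦ s ⊗ m` is a homotopy inverse of `F
⊗_A M → M` (`exists_quasiIso_tens`).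

For the second fact, let `y_j` be a semi-free basis of `F`. A free bimodule tensored with `M` is a
sum of copies of `A ⊗_k M`, where the differential of `M` survives, so the obvious filtration of `F
⊗_A M` has subquotients that need not be DG free. Split `M` over `k` into cocycles `h_i` and pairs
`x, d x`. The elements `y_j ⊗ x` and `d (y_j ⊗ x)`, together with `y_j ⊗ h_i`, form an `A`-basis of
`F ⊗_A M`, because `d (y_j ⊗ x)` is `± y_j ⊗ d x` plus terms of lower level. The pairs span a
contractible DG submodule, and the quotient by it is semi-free on `y_j ⊗ h_i` with the levels of
`F`. It maps back to `F ⊗_A M` by a quasi-isomorphism (`exists_quasiIso_of_pairs`,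
`exists_resolution_tens`).

Filtrations are handled throughout as homogeneous bases with a level function (`SemiBasis`);
`exists_semiBasis` and `dgFreeClass_le` translate in the two directions, the latter also making the
filtration strict. -/

noncomputable section

/-! ### Koszul signs on graded vector spaces -/

section Sign

variable {k : Type u} [Field k] {V : Type u} [AddCommGroup V] [Module k V]

/-- The linear map `v ↦ (-1)^(q|v|) v` of a graded vector space. -/
def gradedSign (gr : ℤ → Submodule k V) [Decomposition gr] (q : ℤ) : V →ₗ[k] V :=
  DirectSum.toModule k ℤ V (fun i => (((q * i).negOnePow : ℤ) : k) • (gr i).subtype) ∘ₗ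
    (decomposeLinearEquiv gr).toLinearMap

lemma gradedSign_apply (gr : ℤ → Submodule k V) [Decomposition gr] (q : ℤ) {i : ℤ} {v : V}
    (hv : v ∈ gr i) : gradedSign gr q v = (q * i).negOnePow • v := by
  lift v to gr i using hv
  simp only [gradedSign, LinearMap.comp_apply, LinearEquiv.coe_coe, decomposeLinearEquiv_apply_coe]
  rw [DirectSum.toModule_lof]
  rcases Int.units_eq_one_or (q * i).negOnePow with h | h <;> rw [h] <;> simp

lemma linearMap_ext_graded (gr : ℤ → Submodule k V) [Decomposition gr] {W : Type*}
    [AddCommGroup W] [Module k W] {f g : V →ₗ[k] W}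
    (h : ∀ i, ∀ v ∈ gr i, f v = g v) : f = g :=
  DirectSum.decompose_lhom_ext gr fun i => by ext a; exact h i a a.2

lemma gradedSign_gradedSign (gr : ℤ → Submodule k V) [Decomposition gr] (q : ℤ) (v : V) :
    gradedSign gr q (gradedSign gr q v) = v := by
  refine LinearMap.congr_fun (f := gradedSign gr q ∘ₗ gradedSign gr q) (g := LinearMap.id)
    (linearMap_ext_graded gr fun i v hv => ?_) v
  rw [LinearMap.comp_apply, gradedSign_apply gr q hv, DGAlg.map_sign, gradedSign_apply gr q hv]
  rcases Int.units_eq_one_or (q * i).negOnePow with h | h <;> rw [h] <;> simp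

end Sign

/-! ### Homogeneous components and homogeneous generators -/

namespace DGMod

variable {k : Type u} [Field k] {A : DGAlg k} {M N P : DGMod A}

lemma sign_smul (i : ℤ) (a : A) (m : M) : (i.negOnePow • a) • m = i.negOnePow • (a • m) := by
  rcases Int.units_eq_one_or i.negOnePow with h | h <;> rw [h] <;> simp

lemma smul_sign (i : ℤ) (a : A) (m : M) : a • (i.negOnePow • m) = i.negOnePow • (a • m) := by
  rcases Int.units_eq_one_or i.negOnePow with h | h <;> rw [h] <;> simp

lemma decompose_smul_apply (i j : ℤ) (a : A) {m : M} (hm : m ∈ M.gr j) :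
    (decompose M.gr (a • m) i : M) = (decompose A.gr a (i - j) : A) • m := by
  induction a using Decomposition.inductionOn A.gr with
  | zero => simp
  | add a a' h h' => simp [add_smul, decompose_add, h, h']
  | @homogeneous l a =>
    have := M.smul_mem l j a m a.2 hm
    by_cases hl : l + j = i
    · subst hl
      rw [decompose_of_mem_same _ this, show l + j - j = l by ring, decompose_of_mem_same _ a.2]
    · rw [decompose_of_mem_ne _ this hl, decompose_of_mem_ne _ a.2 (by omega), zero_smul]

lemma decompose_d_apply (i : ℤ) (m : M) :
    (decompose M.gr (M.d m) (i + 1) : M) = M.d (decompose M.gr m i) := by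
  induction m using Decomposition.inductionOn M.gr with
  | zero => simp
  | add a a' h h' => simp [decompose_add, h, h']
  | @homogeneous l m =>
    have := M.d_mem l m m.2
    by_cases hl : l = i
    · subst hl
      rw [decompose_of_mem_same _ this, decompose_of_mem_same _ m.2]
    · rw [decompose_of_mem_ne _ this (by omega), decompose_of_mem_ne _ m.2 hl, map_zero]

lemma d_smul_mem {S : Submodule A M} {a : A} {m : M} (hm : m ∈ S) (hd : M.d m ∈ S) :
    M.d (a • m) ∈ S := by
  induction a using Decomposition.inductionOn A.gr with
  | zero => simp
  | add a a' h h' => rw [add_smul, map_add]; exact add_mem h h'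
  | homogeneous a =>
    rw [M.leibniz _ _ _ a.2]
    refine add_mem (S.smul_mem _ hm) ?_
    rw [← sign_smul]
    exact S.smul_mem _ hd

/-- The DG submodule spanned by a `d`-stable set of homogeneous elements. -/
def spanHomogeneous (M : DGMod A) (S : Set M) (hS : ∀ s ∈ S, ∃ j, s ∈ M.gr j)
    (hd : ∀ s ∈ S, M.d s ∈ Submodule.span A S) : DGSubmodule M where
  toSub := Submodule.span A S
  homogeneous i m hm := by
    induction hm using Submodule.closure_induction with
    | zero => simp
    | add x y _ _ hx hy => rw [decompose_add]; exact add_mem hx hy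
    | smul_mem a x hx =>
      obtain ⟨j, hj⟩ := hS x hx
      rw [decompose_smul_apply i j a hj]
      exact Submodule.smul_mem _ _ (Submodule.subset_span hx)
  d_mem m hm := by
    induction hm using Submodule.closure_induction with
    | zero => simp
    | add x y _ _ hx hy => rw [map_add]; exact add_mem hx hy
    | smul_mem a x hx => exact d_smul_mem (Submodule.subset_span hx) (hd x hx)

/-- Taking the component of degree `i` of a combination of homogeneous generators makes its
coefficients homogeneous. The degree of a map that is not `A`-linear can thus be checked on products
`a • e j` with `a` homogeneous. -/
lemma mem_span_of_mem_gr {J : Type*} {e : J → M} {deg : J → ℤ} (he : ∀ j, e j ∈ M.gr (deg j))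
    (hs : Submodule.span A (Set.range e) = ⊤) {i : ℤ} {m : M} (hm : m ∈ M.gr i) :
    m ∈ Submodule.span k {x | ∃ j, ∃ a ∈ A.gr (i - deg j), x = a • e j} := by
  rw [← decompose_of_mem_same _ hm]
  have h : m ∈ Submodule.span A (Set.range e) := hs ▸ Submodule.mem_top
  clear hm
  induction h using Submodule.closure_induction with
  | zero => simp
  | add x y _ _ hx hy => rw [decompose_add]; exact add_mem hx hy
  | smul_mem a x hx =>
    obtain ⟨j, rfl⟩ := hx
    rw [decompose_smul_apply i (deg j) a (he j)]
    exact Submodule.subset_span ⟨j, _, (decompose A.gr a (i - deg j)).2, rfl⟩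

end DGMod

/-! ### Projections and inclusions of DG submodules -/

namespace DGSubmodule

variable {k : Type u} [Field k] {A : DGAlg k} {M : DGMod A}

/-- The projection to the quotient by a DG submodule. -/
def proj (N : DGSubmodule M) : M →ₗ[A] N.quotient := N.toSub.mkQ

lemma proj_surjective (N : DGSubmodule M) : Function.Surjective N.proj := N.toSub.mkQ_surjective

lemma proj_eq_zero_iff (N : DGSubmodule M) {m : M} : N.proj m = 0 ↔ m ∈ N.toSub :=
  Submodule.Quotient.mk_eq_zero _

lemma d_proj (N : DGSubmodule M) (m : M) : N.quotient.d (N.proj m) = N.proj (M.d m) := rfl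

lemma mem_quotient_gr_iff (N : DGSubmodule M) {i : ℤ} {x : N.quotient} :
    x ∈ N.quotient.gr i ↔ ∃ m ∈ M.gr i, N.proj m = x := Iff.rfl

/-- The `A`-linear inclusion of a DG submodule. -/
def emb (N : DGSubmodule M) : N.toDGMod →ₗ[A] M := N.toSub.subtype

lemma emb_injective (N : DGSubmodule M) : Function.Injective N.emb := Subtype.val_injective

lemma emb_mem (N : DGSubmodule M) (x : N.toDGMod) : N.emb x ∈ N.toSub := x.2

lemma exists_emb (N : DGSubmodule M) {m : M} (hm : m ∈ N.toSub) : ∃ x, N.emb x = m := ⟨⟨m, hm⟩, rfl⟩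

lemma mem_toDGMod_gr_iff (N : DGSubmodule M) {i : ℤ} {x : N.toDGMod} :
    x ∈ N.toDGMod.gr i ↔ N.emb x ∈ M.gr i := Iff.rfl

lemma emb_d (N : DGSubmodule M) (x : N.toDGMod) : N.emb (N.toDGMod.d x) = M.d (N.emb x) := rfl

end DGSubmodule

/-! ### Quasi-isomorphisms in terms of elements -/

namespace DGHom

variable {k : Type u} [Field k] {A : DGAlg k} {M N P : DGMod A}

/-- Composition of morphisms of DG modules. -/
def comp (g : DGHom N P) (f : DGHom M N) : DGHom M P where
  toLin := g.toLin ∘ₗ f.toLin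
  map_mem i m hm := g.map_mem i _ (f.map_mem i m hm)
  comm m := by simp [f.comm, g.comm]

lemma IsQuasiIso.comp {g : DGHom N P} {f : DGHom M N} (hg : g.IsQuasiIso) (hf : f.IsQuasiIso) :
    (g.comp f).IsQuasiIso := by
  have : ((g.comp f).onCohomology : _ → _) = g.onCohomology ∘ f.onCohomology := by
    ext x
    obtain ⟨x, rfl⟩ := Submodule.mkQ_surjective _ x
    rfl
  rw [IsQuasiIso, this]
  exact Function.Bijective.comp hg hf

lemma onCohomology_mk_eq_zero_iff (f : DGHom M N) (x : LinearMap.ker M.d) :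
    f.onCohomology (Submodule.Quotient.mk x) = 0 ↔ ∃ n, N.d n = f.toLin x := by
  change Submodule.Quotient.mk (f.onCocycles x) = _ ↔ _
  rw [Submodule.Quotient.mk_eq_zero]
  rfl

/-- The two hypotheses are injectivity and surjectivity on cohomology, phrased with cocycles, so
that explicit homotopies can be used without passing to quotients. -/
lemma IsQuasiIso.of_exact {f : DGHom M N}
    (hi : ∀ m, M.d m = 0 → ∀ n, N.d n = f.toLin m → ∃ m', M.d m' = m)
    (hs : ∀ n, N.d n = 0 → ∃ m n', M.d m = 0 ∧ f.toLin m = n + N.d n') : f.IsQuasiIso := by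
  constructor
  · rw [← LinearMap.ker_eq_bot, LinearMap.ker_eq_bot']
    intro x hx
    obtain ⟨x, rfl⟩ := Submodule.Quotient.mk_surjective _ x
    obtain ⟨n, hn⟩ := (f.onCohomology_mk_eq_zero_iff x).1 hx
    exact (Submodule.Quotient.mk_eq_zero _).2 (hi x x.2 n hn)
  · intro y
    obtain ⟨⟨y, hy⟩, rfl⟩ := Submodule.Quotient.mk_surjective _ y
    obtain ⟨m, n', hm, h⟩ := hs y hy
    refine ⟨Submodule.Quotient.mk ⟨m, hm⟩, ?_⟩
    refine (Submodule.Quotient.eq _).2 ?_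
    refine ⟨n', ?_⟩
    change N.d n' = f.toLin m - y
    rw [h]; abel

lemma IsQuasiIso.injective {f : DGHom M N} (hf : f.IsQuasiIso) {m : M} (hm : M.d m = 0) {n : N}
    (hn : N.d n = f.toLin m) : ∃ m', M.d m' = m := by
  have := (f.onCohomology_mk_eq_zero_iff ⟨m, hm⟩).2 ⟨n, hn⟩
  rw [← map_zero f.onCohomology] at this
  exact (Submodule.Quotient.mk_eq_zero _).1 (hf.1 this)

lemma IsQuasiIso.surjective {f : DGHom M N} (hf : f.IsQuasiIso) {n : N} (hn : N.d n = 0) :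
    ∃ m n', M.d m = 0 ∧ f.toLin m = n + N.d n' := by
  obtain ⟨y, hy⟩ := hf.2 (Submodule.Quotient.mk ⟨n, hn⟩)
  obtain ⟨⟨y, hm⟩, rfl⟩ := Submodule.Quotient.mk_surjective _ y
  obtain ⟨n', hn'⟩ := (Submodule.Quotient.eq _).1 hy
  refine ⟨y, n', hm, ?_⟩
  have : N.d n' = f.toLin y - n := hn'
  rw [this]; abel

/-- A morphism with a right inverse `g` such that `g f` is homotopic to the identity is a
quasi-isomorphism. -/
lemma IsQuasiIso.of_rightInverse {f : DGHom M N} (g : N →ₗ[k] M)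
    (hg : ∀ n, g (N.d n) = M.d (g n)) (h : M →ₗ[k] M) (hfg : ∀ n, f.toLin (g n) = n)
    (hgf : ∀ m, M.d (h m) + h (M.d m) = m - g (f.toLin m)) : f.IsQuasiIso := by
  refine .of_exact (fun m hm n hn => ⟨h m + g n, ?_⟩) fun n hn => ⟨g n, 0, ?_, ?_⟩
  · have := hgf m
    rw [hm, map_zero, add_zero] at this
    rw [map_add, this, ← hg, hn]; abel
  · rw [← hg, hn, map_zero]
  · rw [hfg, map_zero, add_zero]

/-- A morphism with a left inverse `g` such that `f g` is homotopic to the identity is a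
quasi-isomorphism. -/
lemma IsQuasiIso.of_leftInverse {f : DGHom M N} (g : N →ₗ[k] M)
    (hg : ∀ n, g (N.d n) = M.d (g n)) (h : N →ₗ[k] N) (hgf : ∀ m, g (f.toLin m) = m)
    (hfg : ∀ n, N.d (h n) + h (N.d n) = n - f.toLin (g n)) : f.IsQuasiIso := by
  refine .of_exact (fun m hm n hn => ⟨g n, ?_⟩) fun n hn => ⟨g n, -(h n), ?_, ?_⟩
  · rw [← hg, hn, hgf]
  · rw [← hg, hn, map_zero]
  · have := hfg n
    rw [hn, map_zero, add_zero] at this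
    rw [map_neg, this]; abel

end DGHom

/-! ### Semi-free bases and the filtrations they define -/

namespace DGMod

variable {k : Type u} [Field k] {A : DGAlg k} {F M : DGMod A}

/-- A semi-free basis with levels `0, …, n`: a homogeneous basis for which `d` sends each basis
element to a combination of basis elements of lower level. -/
structure SemiBasis (F : DGMod A) (n : ℕ) where
  J : Type u
  b : Module.Basis J A F
  deg : J → ℤ
  mem : ∀ j, b j ∈ F.gr (deg j)
  lev : J → ℕ
  lev_le : ∀ j, lev j ≤ n
  d_mem : ∀ j, F.d (b j) ∈ Submodule.span A (b '' {i | lev i < lev j})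

namespace SemiBasis

variable {n : ℕ}

/-- The DG submodule spanned by the basis elements of level less than `i`. -/
def fil (B : F.SemiBasis n) (i : ℕ) : DGSubmodule F :=
  F.spanHomogeneous (B.b '' {j | B.lev j < i}) (by rintro _ ⟨j, -, rfl⟩; exact ⟨_, B.mem j⟩)
    (by
      rintro _ ⟨j, hj, rfl⟩
      have hsub : {l | B.lev l < B.lev j} ⊆ {l | B.lev l < i} := fun l (hl : B.lev l < B.lev j) =>
        hl.trans hj
      exact Submodule.span_mono (Set.image_mono hsub) (B.d_mem j))

lemma fil_mono (B : F.SemiBasis n) {i j : ℕ} (h : i ≤ j) : (B.fil i).toSub ≤ (B.fil j).toSub :=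
  Submodule.span_mono (Set.image_mono fun _ hl => lt_of_lt_of_le hl h)

lemma fil_eq_top (B : F.SemiBasis n) : (B.fil (n + 1)).toSub = ⊤ := by
  have : {j | B.lev j < n + 1} = Set.univ := by
    ext j; simpa using Nat.lt_succ_of_le (B.lev_le j)
  change Submodule.span A _ = _
  rw [this, Set.image_univ, B.b.span_eq]

lemma mem_fil_iff (B : F.SemiBasis n) {i : ℕ} {x : F} :
    x ∈ (B.fil i).toSub ↔ ∀ j, B.b.repr x j ≠ 0 → B.lev j < i := by
  change x ∈ Submodule.span A _ ↔ _
  rw [Module.Basis.mem_span_image]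
  simp [Set.subset_def]

/-- The classes of the basis elements of level `i` form a basis of the subquotient, and they are
cocycles there because `d` lowers the level. -/
lemma fil_free (B : F.SemiBasis n) (i : ℕ) :
    ((B.fil i).subquotient (B.fil (i + 1))).IsDGFree := by
  change ((B.fil i).restrictTo (B.fil (i + 1))).quotient.IsDGFree
  have hmem : ∀ j, B.lev j < i + 1 → B.b j ∈ (B.fil (i + 1)).toSub := fun j hj =>
    Submodule.subset_span ⟨j, hj, rfl⟩
  have hw : ∀ y : {j // B.lev j = i}, ∃ x, (B.fil (i + 1)).emb x = B.b y := fun y =>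
    (B.fil (i + 1)).exists_emb (hmem y (by simp [y.2]))
  choose w hw using hw
  have hproj : ∀ x, ((B.fil i).restrictTo (B.fil (i + 1))).proj x = 0 ↔
      (B.fil (i + 1)).emb x ∈ (B.fil i).toSub := fun x => DGSubmodule.proj_eq_zero_iff _
  have li : LinearIndependent A fun y => ((B.fil i).restrictTo (B.fil (i + 1))).proj (w y) := by
    rw [linearIndependent_iff]
    intro l hl
    change Finsupp.linearCombination A (((B.fil i).restrictTo (B.fil (i + 1))).proj ∘ w) l = 0 at hl
    rw [← Finsupp.apply_linearCombination, hproj, Finsupp.apply_linearCombination] at hl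
    ext y
    by_contra hy
    have h4 := B.mem_fil_iff.1 hl y
    rw [show (B.fil (i + 1)).emb ∘ w = B.b ∘ Subtype.val from funext hw,
      ← Finsupp.linearCombination_mapDomain, B.b.repr_linearCombination,
      Finsupp.mapDomain_apply Subtype.val_injective] at h4
    exact absurd (h4 hy) (by simp [y.2])
  have sp : ⊤ ≤ Submodule.span A
      (Set.range fun y => ((B.fil i).restrictTo (B.fil (i + 1))).proj (w y)) := by
    rintro x -
    obtain ⟨x, rfl⟩ := DGSubmodule.proj_surjective _ x
    generalize hm : (B.fil (i + 1)).emb x = m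
    have hx : m ∈ Submodule.span A (B.b '' {j | B.lev j < i + 1}) := hm ▸ (B.fil (i + 1)).emb_mem x
    induction hx using Submodule.closure_induction generalizing x with
    | zero =>
      rw [← map_zero (B.fil (i + 1)).emb] at hm
      rw [(B.fil (i + 1)).emb_injective hm, map_zero]
      exact zero_mem _
    | add y z hy hz h h' =>
      obtain ⟨y, rfl⟩ := (B.fil (i + 1)).exists_emb hy
      obtain ⟨z, rfl⟩ := (B.fil (i + 1)).exists_emb hz
      rw [← map_add] at hm
      rw [(B.fil (i + 1)).emb_injective hm, map_add]
      exact add_mem (h y rfl) (h' z rfl)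
    | smul_mem a y hy =>
      obtain ⟨j, hj, rfl⟩ := hy
      obtain ⟨y, hy⟩ := (B.fil (i + 1)).exists_emb (hmem j hj)
      rw [← hy, ← map_smul] at hm
      rw [(B.fil (i + 1)).emb_injective hm, map_smul]
      refine Submodule.smul_mem _ _ ?_
      rcases Nat.lt_succ_iff_lt_or_eq.1 hj with h | h
      · rw [(hproj y).2 (hy ▸ Submodule.subset_span ⟨j, h, rfl⟩)]
        exact zero_mem _
      · rw [← hw ⟨j, h⟩] at hy
        rw [(B.fil (i + 1)).emb_injective hy]
        exact Submodule.subset_span ⟨_, rfl⟩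
  refine ⟨_, Module.Basis.mk li sp, fun y => ⟨⟨B.deg y, ?_⟩, ?_⟩⟩
  · rw [Module.Basis.mk_apply]
    refine (DGSubmodule.mem_quotient_gr_iff _).2 ⟨w y, ?_, rfl⟩
    rw [DGSubmodule.mem_toDGMod_gr_iff, hw]
    exact B.mem y
  · rw [Module.Basis.mk_apply]
    refine (DGSubmodule.d_proj _ (w y)).trans ?_
    rw [hproj, DGSubmodule.emb_d, hw]
    have := B.d_mem y
    rwa [y.2] at this

/-- The semi-free filtration defined by a semi-free basis. -/
def filtration (B : F.SemiBasis n) : F.SemiFreeFiltration where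
  fil := B.fil
  bot := by
    change Submodule.span A _ = _
    simp
  mono i := B.fil_mono i.le_succ
  union x := ⟨n + 1, by rw [B.fil_eq_top]; trivial⟩
  free := B.fil_free

/-- A basis element of level `i` witnesses that the filtration grows at that step: its own
coordinate is `1`, which is nonzero in `A`. If no level is skipped, the filtration is therefore
strict and of length exactly `n`. -/
lemma dgFreeClass_le_of_surjective [Nontrivial A] (B : F.SemiBasis n)
    (h : ∀ i ≤ n, ∃ j, B.lev j = i) : F.dgFreeClass ≤ n := by
  have key : ∀ i ≤ n, ∃ x ∈ (B.fil (i + 1)).toSub, x ∉ (B.fil i).toSub := by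
    intro i hi
    obtain ⟨j, hj⟩ := h i hi
    refine ⟨B.b j, Submodule.subset_span ⟨j, by simp [hj], rfl⟩, fun h => ?_⟩
    have := B.mem_fil_iff.1 h j (by simp)
    omega
  refine iInf₂_le n ⟨B.filtration, fun i hi h => ?_, B.fil_eq_top, fun hn h => ?_⟩
  · by_cases hin : i ≤ n
    · obtain ⟨x, hx, hx'⟩ := key i hin
      have : (B.fil i).toSub = (B.fil (i + 1)).toSub := h
      exact hx' (this ▸ hx)
    · exact hi (top_le_iff.1 (B.fil_eq_top ▸ B.fil_mono (by omega)))
  · obtain ⟨x, hx, hx'⟩ := key n le_rfl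
    have : (B.fil n).toSub = ⊤ := h
    exact hx' (this ▸ trivial)

/-- Empty levels would break strictness. They are removed by renumbering the occupied levels
consecutively, which can only shorten the filtration. -/
lemma dgFreeClass_le [Nontrivial A] (B : F.SemiBasis n) : F.dgFreeClass ≤ n := by
  classical
  by_cases hJ : Nonempty B.J
  swap
  -- An empty basis means `F = 0`: every term of the filtration is already everything, so strictness
  -- is vacuous and the length is `0`.
  · rw [not_nonempty_iff] at hJ
    have htop : ∀ i, (B.filtration.fil i).toSub = ⊤ := fun i => by
      refine top_le_iff.1 fun x _ => B.mem_fil_iff.2 fun j => isEmptyElim j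
    exact (iInf₂_le 0 ⟨B.filtration, fun i hi => absurd (htop i) hi, htop _, by simp⟩).trans
      (by simp)
  -- `p` marks the occupied levels. The new level of `j` is the number of occupied levels below
  -- `B.lev j`, and `m + 1` is the number of all occupied levels.
  let p : ℕ → Prop := fun i => ∃ j, B.lev j = i
  have hp : ∀ j, Nat.count p (B.lev j) < Nat.count p (n + 1) := fun j =>
    Nat.count_strict_mono ⟨j, rfl⟩ (Nat.lt_succ_of_le (B.lev_le j))
  obtain ⟨m, hm⟩ : ∃ m, Nat.count p (n + 1) = m + 1 :=
    Nat.exists_eq_succ_of_ne_zero (by have := hp hJ.some; omega)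
  let B' : F.SemiBasis m :=
    { J := B.J, b := B.b, deg := B.deg, mem := B.mem
      lev := fun j => Nat.count p (B.lev j)
      lev_le := fun j => by have := hp j; omega
      d_mem := fun j => Submodule.span_mono (Set.image_mono fun i hi =>
        Nat.count_strict_mono ⟨i, rfl⟩ hi) (B.d_mem j) }
  have hB' : F.dgFreeClass ≤ m := by
    refine B'.dgFreeClass_le_of_surjective fun i hi => ?_
    have hc : ∀ hf : (Set.ofPred p).Finite, i < hf.toFinset.card := by
      intro hf
      refine lt_of_lt_of_le (show i < Nat.count p (n + 1) by omega) ?_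
      rw [Nat.count_eq_card_filter_range]
      exact Finset.card_le_card fun x hx => by simpa using (Finset.mem_filter.1 hx).2
    -- The `i`-th occupied level is the one that is renumbered to `i`.
    obtain ⟨j, hj⟩ := Nat.nth_mem (p := p) i hc
    refine ⟨j, ?_⟩
    change Nat.count p (B.lev j) = i
    rw [hj, Nat.count_nth hc]
  have : m ≤ n := by
    have := Nat.count_le (p := p) (n := n + 1)
    omega
  exact hB'.trans (by exact_mod_cast this)

lemma coneLength_le [Nontrivial A] (B : F.SemiBasis n) {f : DGHom F M} (hf : f.IsQuasiIso) :
    M.coneLength ≤ n :=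
  (iInf₂_le F ⟨B.filtration⟩).trans ((iInf_le _ ⟨f, hf⟩).trans B.dgFreeClass_le)

end SemiBasis

end DGMod

/-! ### Bases adapted to a filtration -/

section FilteredBasis

variable {R V J : Type*} [Ring R] [AddCommGroup V] [Module R V]

/-- A family of vectors that induces bases of the subquotients of an exhaustive filtration is
linearly independent, and its members of level less than `n` span the `n`-th term. -/
lemma filtered_family (fil : ℕ → Submodule R V) (e : J → V) (lev : J → ℕ) (bot : fil 0 = ⊥)
    (mono : Monotone fil) (mem : ∀ j, e j ∈ fil (lev j + 1))
    (span : ∀ n, fil (n + 1) ≤ fil n ⊔ Submodule.span R (e '' {j | lev j = n}))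
    (indep : ∀ n, ∀ l : J →₀ R, (∀ j, l j ≠ 0 → lev j = n) →
      Finsupp.linearCombination R e l ∈ fil n → l = 0) :
    LinearIndependent R e ∧ ∀ n, fil n ≤ Submodule.span R (e '' {j | lev j < n}) := by
  classical
  constructor
  · have key : ∀ n, ∀ l : J →₀ R, (∀ j, l j ≠ 0 → lev j < n) →
        Finsupp.linearCombination R e l = 0 → l = 0 := by
      intro n
      induction n with
      | zero =>
        intro l hl _
        ext j
        by_contra hj
        exact absurd (hl j hj) (by simp)
      | succ n ih =>
        intro l hl h0
        -- In a vanishing combination the part of top level is minus the part of lower level, hence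
        -- lies in `fil n`; independence in the subquotient kills it.
        have h1 : l.filter (fun j => lev j = n) = 0 := by
          refine indep n _ (fun j hj => ?_) ?_
          · by_contra hne
            exact hj (Finsupp.filter_apply_neg _ _ hne)
          · have h2 := Finsupp.filter_add_filter_not l (fun j => lev j = n)
            rw [← h2, map_add, add_eq_zero_iff_eq_neg] at h0
            rw [h0, Finsupp.linearCombination_apply]
            refine neg_mem (Submodule.sum_mem _ fun j hj => Submodule.smul_mem _ _ ?_)
            rw [Finsupp.support_filter, Finset.mem_filter] at hj
            have := hl j (Finsupp.mem_support_iff.1 hj.1)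
            exact mono (by omega : lev j + 1 ≤ n) (mem j)
        refine ih l (fun j hj => ?_) h0
        refine lt_of_le_of_ne (Nat.lt_succ_iff.1 (hl j hj)) fun hne => hj ?_
        rw [← Finsupp.filter_apply_pos (fun j => lev j = n) l hne, h1]
        rfl
    rw [linearIndependent_iff]
    intro l hl
    refine key (l.support.sup lev + 1) l (fun j hj => ?_) hl
    exact Nat.lt_succ_of_le (Finset.le_sup (Finsupp.mem_support_iff.2 hj))
  · intro n
    induction n with
    | zero => rw [bot]; exact bot_le
    | succ n ih =>
      refine (span n).trans (sup_le (ih.trans ?_) ?_)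
      · exact Submodule.span_mono (Set.image_mono fun j (hj : lev j < n) => hj.trans n.lt_succ_self)
      · exact Submodule.span_mono (Set.image_mono fun j (hj : lev j = n) =>
          show lev j < n + 1 by omega)

/-- A unitriangular change of a basis. -/
lemma exists_basis_of_triangular (b : Module.Basis J R V) (lev : J → ℕ) (e : J → V) (ε : J → ℤˣ)
    (h : ∀ j, e j - ε j • b j ∈ Submodule.span R (b '' {i | lev i < lev j})) :
    ∃ b' : Module.Basis J R V, ⇑b' = e ∧
      ∀ n, Submodule.span R (b '' {i | lev i < n}) ≤ Submodule.span R (e '' {i | lev i < n}) := by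
  classical
  have mono : Monotone fun n => Submodule.span R (b '' {i | lev i < n}) := fun m n hmn =>
    Submodule.span_mono (Set.image_mono fun j (hj : lev j < m) => lt_of_lt_of_le hj hmn)
  have hε : ∀ j (v : V), ε j • (ε j • v) = v := fun j v => by
    rcases Int.units_eq_one_or (ε j) with h | h <;> rw [h] <;> simp
  have hmem : ∀ (S : Submodule R V) (j : J) (v : V), v ∈ S → ε j • v ∈ S := fun S j v hv => by
    rcases Int.units_eq_one_or (ε j) with h | h <;> rw [h] <;> simpa using hv
  -- Filter by the levels of the old basis. Modulo lower levels `e j` is `± b j`, so it induces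
  -- bases of the same subquotients.
  obtain ⟨li, sp⟩ := filtered_family (fun n => Submodule.span R (b '' {i | lev i < n})) e lev
    (by simp) mono (fun j => by
      rw [← sub_add_cancel (e j) (ε j • b j)]
      exact add_mem (mono (lev j).le_succ (h j))
        (hmem _ _ _ (Submodule.subset_span ⟨j, Nat.lt_succ_self _, rfl⟩)))
    (fun n => by
      rw [Submodule.span_le]
      rintro _ ⟨j, hj, rfl⟩
      rcases Nat.lt_succ_iff_lt_or_eq.1 hj with hj | rfl
      · exact Submodule.mem_sup_left (Submodule.subset_span ⟨j, hj, rfl⟩)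
      · have : b j = -(ε j • (e j - ε j • b j)) + ε j • e j := by
          rw [smul_sub, hε]; abel
        rw [this]
        exact add_mem (Submodule.mem_sup_left (neg_mem (hmem _ _ _ (h j))))
          (hmem _ _ _ (Submodule.mem_sup_right (Submodule.subset_span ⟨j, rfl, rfl⟩))))
    (fun n l hl hmem' => by
      -- Replacing every `e j` of level `n` by `ε j • b j` changes the combination only by terms of
      -- level less than `n`; afterwards the coefficients can be read off as coordinates.
      have h1 : l.sum (fun j a => a • (ε j • b j)) ∈ Submodule.span R (b '' {i | lev i < n}) := by
        have : l.sum (fun j a => a • (ε j • b j)) = Finsupp.linearCombination R e l -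
            l.sum (fun j a => a • (e j - ε j • b j)) := by
          rw [Finsupp.linearCombination_apply, ← Finsupp.sum_sub]
          refine Finsupp.sum_congr fun j _ => ?_
          rw [smul_sub]; abel
        rw [this]
        refine sub_mem hmem' (Submodule.sum_mem _ fun j hj => Submodule.smul_mem _ _ ?_)
        have := h j
        rwa [hl j (Finsupp.mem_support_iff.1 hj)] at this
      ext j
      by_contra hj
      have h2 : ∀ i, b.repr (l.sum fun j a => a • (ε j • b j)) i = ε i • l i := by
        intro i
        rw [Finsupp.sum, map_sum, Finset.sum_apply']
        have : ∀ x ∈ l.support, b.repr (l x • ε x • b x) i = if x = i then ε i • l i else 0 := by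
          intro x _
          split_ifs with hx
          · subst hx
            rcases Int.units_eq_one_or (ε x) with h | h <;> rw [h] <;> simp
          · rcases Int.units_eq_one_or (ε x) with h | h <;> rw [h] <;>
              simp [hx]
        rw [Finset.sum_congr rfl this, Finset.sum_ite_eq']
        split_ifs with hi
        · rfl
        · rw [Finsupp.notMem_support_iff.1 hi, smul_zero]
      rw [Module.Basis.mem_span_image] at h1
      have h3 : j ∈ (b.repr (l.sum fun j a => a • (ε j • b j))).support := by
        rw [Finsupp.mem_support_iff, h2]
        intro h0
        refine hj ?_
        rcases Int.units_eq_one_or (ε j) with h | h <;> rw [h] at h0 <;> simpa using h0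
      have h4 : lev j < n := h1 h3
      rw [hl j hj] at h4
      exact lt_irrefl _ h4)
  refine ⟨Module.Basis.mk li ?_, Module.Basis.coe_mk _ _, sp⟩
  rw [← b.span_eq, Submodule.span_le]
  rintro _ ⟨j, rfl⟩
  exact Submodule.span_mono (Set.image_subset_range _ _)
    (sp (lev j + 1) (Submodule.subset_span ⟨j, Nat.lt_succ_self _, rfl⟩))

end FilteredBasis

/-! ### From a semi-free filtration to a semi-free basis -/

namespace DGMod

variable {k : Type u} [Field k] {A : DGAlg k}

/-- Homogeneous lifts of the bases of the subquotients form a basis of `F`. The differential of a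
lift vanishes in its subquotient, so it lies in the preceding term, which is spanned by the lifts of
lower level. -/
lemma exists_semiBasis {F : DGMod A} (φ : F.SemiFreeFiltration) {n : ℕ}
    (hn : (φ.fil (n + 1)).toSub = ⊤) : Nonempty (F.SemiBasis n) := by
  have mono : Monotone fun i => (φ.fil i).toSub := monotone_nat_of_le_succ φ.mono
  have hfree : ∀ i, ((φ.fil i).restrictTo (φ.fil (i + 1))).quotient.IsDGFree := φ.free
  choose Y e he using hfree
  have hdeg : ∀ i y, ∃ (j : ℤ) (w : (φ.fil (i + 1)).toDGMod), (φ.fil (i + 1)).emb w ∈ F.gr j ∧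
      ((φ.fil i).restrictTo (φ.fil (i + 1))).proj w = e i y := by
    intro i y
    obtain ⟨⟨j, w, hw, h⟩, -⟩ := he i y
    exact ⟨j, w, hw, h⟩
  choose deg w hw hwe using hdeg
  -- Only the subquotients up to `n` are used, which bounds the levels. Beyond that point the
  -- filtration is already everything, so the conditions at the levels above `n` are trivial.
  let J := Σ i : {i // i ≤ n}, Y i
  let v : J → F := fun j => (φ.fil (j.1 + 1)).emb (w j.1 j.2)
  have hproj : ∀ i x, ((φ.fil i).restrictTo (φ.fil (i + 1))).proj x = 0 ↔
      (φ.fil (i + 1)).emb x ∈ (φ.fil i).toSub := fun i x => DGSubmodule.proj_eq_zero_iff _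
  obtain ⟨li, sp⟩ := filtered_family (fun i => (φ.fil i).toSub) v (fun j => j.1) φ.bot mono
    (fun j => (φ.fil (j.1 + 1)).emb_mem _)
    (fun i => by
      by_cases hi : i ≤ n
      · intro x hx
        obtain ⟨x, rfl⟩ := (φ.fil (i + 1)).exists_emb hx
        have h1 : ∀ z ∈ Submodule.span A (Set.range (e i)), ∃ x',
            ((φ.fil i).restrictTo (φ.fil (i + 1))).proj x' = z ∧
            (φ.fil (i + 1)).emb x' ∈ Submodule.span A (v '' {j | (j.1 : ℕ) = i}) := by
          intro z hz
          induction hz using Submodule.span_induction with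
          | mem z hz =>
            obtain ⟨y, rfl⟩ := hz
            exact ⟨w i y, hwe i y, Submodule.subset_span ⟨⟨⟨i, hi⟩, y⟩, rfl, rfl⟩⟩
          | zero => exact ⟨0, map_zero _, by rw [map_zero]; exact zero_mem _⟩
          | add z z' _ _ h h' =>
            obtain ⟨x, rfl, hx⟩ := h
            obtain ⟨x', rfl, hx'⟩ := h'
            exact ⟨x + x', map_add _ _ _, by rw [map_add]; exact add_mem hx hx'⟩
          | smul a z _ h =>
            obtain ⟨x, rfl, hx⟩ := h
            exact ⟨a • x, map_smul _ _ _, by rw [map_smul]; exact Submodule.smul_mem _ _ hx⟩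
        obtain ⟨x', hx', hx''⟩ := h1 (((φ.fil i).restrictTo (φ.fil (i + 1))).proj x)
          (by rw [(e i).span_eq]; trivial)
        -- `x'` is a combination of lifts with the same class as `x` in the subquotient.
        have : (φ.fil (i + 1)).emb (x - x') ∈ (φ.fil i).toSub := by
          rw [← hproj, map_sub, hx', sub_self]
        rw [← sub_add_cancel x x', map_add]
        exact add_mem (Submodule.mem_sup_left this) (Submodule.mem_sup_right hx'')
      · refine le_trans ?_ le_sup_left
        have : (φ.fil i).toSub = ⊤ := top_le_iff.1 (hn ▸ mono (by omega : n + 1 ≤ i))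
        rw [this]
        exact le_top)
    (fun i l hl h => by
      by_cases hi : i ≤ n
      · let ι : Y i → J := fun y => ⟨⟨i, hi⟩, y⟩
        have hι : Function.Injective ι := fun y y' h => eq_of_heq (Sigma.mk.inj h).2
        have hs : ∀ j, l j ≠ 0 → j ∈ Set.range ι := by
          rintro ⟨⟨i', hi'⟩, y⟩ hj
          obtain rfl : i' = i := hl _ hj
          exact ⟨y, rfl⟩
        obtain ⟨l', rfl⟩ : ∃ l', l = Finsupp.mapDomain ι l' := by
          refine ⟨l.comapDomain ι hι.injOn, (Finsupp.mapDomain_comapDomain ι hι l ?_).symm⟩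
          intro j hj
          exact hs j (Finsupp.mem_support_iff.1 hj)
        rw [Finsupp.linearCombination_mapDomain, show v ∘ ι = (φ.fil (i + 1)).emb ∘ w i from rfl,
          ← Finsupp.apply_linearCombination, ← hproj, Finsupp.apply_linearCombination,
          show _ ∘ w i = e i from funext (hwe i)] at h
        rw [linearIndependent_iff.1 (e i).linearIndependent l' h, Finsupp.mapDomain_zero]
      · ext j
        by_contra hj
        exact hi (hl j hj ▸ j.1.2))
  have sp' : ⊤ ≤ Submodule.span A (Set.range v) := by
    rw [← hn]
    exact (sp (n + 1)).trans (Submodule.span_mono (Set.image_subset_range _ _))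
  refine ⟨⟨J, Module.Basis.mk li sp', fun j => deg j.1 j.2, fun j => ?_, fun j => j.1,
    fun j => j.1.2, fun j => ?_⟩⟩
  · rw [Module.Basis.mk_apply]
    exact hw _ _
  · rw [Module.Basis.coe_mk]
    refine sp _ ?_
    change F.d ((φ.fil (j.1 + 1)).emb (w j.1 j.2)) ∈ (φ.fil j.1).toSub
    rw [← DGSubmodule.emb_d, ← hproj, ← DGSubmodule.d_proj, hwe]
    exact (he _ _).2

end DGMod

/-! ### Cancellation of contractible pairs -/

namespace DGAlg

variable {k : Type u} [Field k] (A : DGAlg k)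

lemma sgn_mul (a b : A) : A.sgn (a * b) = A.sgn a * A.sgn b := by
  induction a using Decomposition.inductionOn A.gr with
  | zero => simp
  | add a a' h h' => simp only [map_add, add_mul, h, h']
  | @homogeneous i a =>
  induction b using Decomposition.inductionOn A.gr with
  | zero => simp
  | add a a' h h' => simp only [map_add, mul_add, h, h']
  | @homogeneous j b =>
  rw [A.sgn_apply a.2, A.sgn_apply b.2, A.sgn_apply (SetLike.mul_mem_graded a.2 b.2),
    sign_mul_left, sign_mul_right, smul_smul, Int.negOnePow_add]

lemma sgn_mem {i : ℤ} {a : A} (ha : a ∈ A.gr i) : A.sgn a ∈ A.gr i := by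
  rw [A.sgn_apply ha]
  exact sign_mem _ _ ha

lemma sgn_one : A.sgn 1 = 1 := by
  rw [A.sgn_apply (SetLike.one_mem_graded A.gr)]
  simp

end DGAlg

namespace DGMod

variable {k : Type u} [Field k] {A : DGAlg k} {P : DGMod A}

/-- The map `∑ a_j b_j ↦ ∑ (-1)^|a_j| a_j w_j` defined by a basis `b` and vectors `w`. -/
def antilinearExt {J : Type u} (b : Module.Basis J A P) (w : J → P) : P →ₗ[k] P :=
  Finsupp.lsum k (fun j => (LinearMap.toSpanSingleton A P (w j)).restrictScalars k ∘ₗ A.sgn) ∘ₗ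
    b.repr.toLinearMap.restrictScalars k

section AntilinearExt

variable {J : Type u} (b : Module.Basis J A P) (w : J → P)

lemma antilinearExt_smul_basis (a : A) (j : J) :
    antilinearExt b w (a • b j) = A.sgn a • w j := by
  simp [antilinearExt]

lemma antilinearExt_basis (j : J) : antilinearExt b w (b j) = w j := by
  have := antilinearExt_smul_basis b w 1 j
  rwa [one_smul, A.sgn_one, one_smul] at this

lemma basis_induction {p : P → Prop} (x : P) (zero : p 0) (add : ∀ x y, p x → p y → p (x + y))
    (smul : ∀ (a : A) j, p (a • b j)) : p x := by
  have hx : x ∈ Submodule.span A (Set.range b) := by rw [b.span_eq]; trivial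
  induction hx using Submodule.closure_induction with
  | zero => exact zero
  | add x y _ _ hx hy => exact add x y hx hy
  | smul_mem a x hx =>
    obtain ⟨j, rfl⟩ := hx
    exact smul a j

lemma antilinearExt_smul (a : A) (x : P) :
    antilinearExt b w (a • x) = A.sgn a • antilinearExt b w x := by
  induction x using basis_induction b with
  | zero => simp
  | add x y hx hy => simp only [smul_add, map_add, hx, hy]
  | smul a' j =>
    rw [smul_smul, antilinearExt_smul_basis, antilinearExt_smul_basis, A.sgn_mul, mul_smul]

/-- The sign twist in `antilinearExt` is that of a map of degree `-1`. It makes the two terms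
containing `d a` cancel, so `d c + c d` is honestly `A`-linear although `c` is not. -/
lemma homotopy_smul (a : A) (x : P) :
    P.d (antilinearExt b w (a • x)) + antilinearExt b w (P.d (a • x)) =
      a • (P.d (antilinearExt b w x) + antilinearExt b w (P.d x)) := by
  induction a using Decomposition.inductionOn A.gr with
  | zero => simp
  | add a a' h h' =>
    simp only [add_smul, map_add] at h h' ⊢
    rw [← h, ← h']; abel
  | @homogeneous i a =>
    rw [P.leibniz i _ _ a.2, map_add, DGAlg.map_sign, antilinearExt_smul, antilinearExt_smul,
      antilinearExt_smul, A.sgn_apply a.2, A.sgn_apply (A.d_mem _ _ a.2), sign_smul, sign_smul,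
      sign_smul, DGAlg.map_sign, P.leibniz i _ _ a.2, Int.negOnePow_succ]
    rcases Int.units_eq_one_or i.negOnePow with h | h <;> rw [h] <;> simp <;> abel

lemma antilinearExt_mem {deg : J → ℤ} (hb : ∀ j, b j ∈ P.gr (deg j))
    (hw : ∀ j, w j ∈ P.gr (deg j - 1)) {i : ℤ} {x : P} (hx : x ∈ P.gr i) :
    antilinearExt b w x ∈ P.gr (i - 1) := by
  refine Submodule.span_le (p := (P.gr (i - 1)).comap (antilinearExt b w)).2 ?_
    (mem_span_of_mem_gr hb b.span_eq hx)
  rintro _ ⟨j, a, ha, rfl⟩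
  change antilinearExt b w (a • b j) ∈ P.gr (i - 1)
  rw [antilinearExt_smul_basis, show i - 1 = i - deg j + (deg j - 1) by ring]
  exact P.smul_mem _ _ _ _ (A.sgn_mem ha) (hw j)

end AntilinearExt

/-- Cancellation of a contractible summand: if `P` has a homogeneous basis that consists of
elements `b_j` and pairs `x, d x`, then `P` is resolved by its quotient modulo the pairs. -/
theorem exists_quasiIso_of_pairs {J X : Type u} (b : Module.Basis (J ⊕ X ⊕ X) A P)
    (degX : X → ℤ) (hX : ∀ x, b (.inr (.inl x)) ∈ P.gr (degX x))
    (hd : ∀ x, b (.inr (.inr x)) = P.d (b (.inr (.inl x))))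
    (degJ : J → ℤ) (hJ : ∀ j, b (.inl j) ∈ P.gr (degJ j)) (n : ℕ) (lev : J → ℕ)
    (hlev : ∀ j, lev j ≤ n)
    (hdJ : ∀ j, P.d (b (.inl j)) ∈ Submodule.span A ((b ∘ .inl) '' {i | lev i < lev j}) ⊔
      Submodule.span A (Set.range (b ∘ .inr))) :
    ∃ (G : DGMod A) (_ : G.SemiBasis n) (s : DGHom G P), s.IsQuasiIso := by
  -- The contraction `c` of the pairs sends `d x` to `x` and every other basis element to `0`.
  let w : J ⊕ X ⊕ X → P := Sum.elim (fun _ => 0) (Sum.elim (fun _ => 0) fun x => b (.inr (.inl x)))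
  let c := antilinearExt b w
  have hc : ∀ j, c (b j) = w j := antilinearExt_basis b w
  let C : DGSubmodule P := P.spanHomogeneous (Set.range (b ∘ .inr))
    (by
      rintro _ ⟨x | x, rfl⟩
      · exact ⟨_, hX x⟩
      · exact ⟨degX x + 1, by rw [Function.comp_apply, hd]; exact P.d_mem _ _ (hX x)⟩)
    (by
      rintro _ ⟨x | x, rfl⟩
      · rw [Function.comp_apply, ← hd]
        exact Submodule.subset_span ⟨.inr x, rfl⟩
      · rw [Function.comp_apply, hd, P.d_d]
        exact zero_mem _)
  have hcC : ∀ p, c p ∈ C.toSub := by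
    intro p
    induction p using basis_induction b with
    | zero => rw [map_zero]; exact zero_mem _
    | add x y hx hy => rw [map_add]; exact add_mem hx hy
    | smul a j =>
      change antilinearExt b w (a • b j) ∈ _
      rw [antilinearExt_smul_basis]
      refine Submodule.smul_mem _ _ ?_
      rcases j with j | x | x
      · exact zero_mem _
      · exact zero_mem _
      · exact Submodule.subset_span ⟨.inl x, rfl⟩
  -- `H = d c + c d` is a projection onto the span `C` of the pairs that commutes with `d` and has
  -- degree `0`; hence `C` is a direct summand as a DG module.
  let H : P →ₗ[A] P :=
    { toFun := fun p => P.d (c p) + c (P.d p)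
      map_add' := fun p q => by simp only [map_add]; abel
      map_smul' := fun a p => homotopy_smul b w a p }
  have hH : ∀ p, H p = P.d (c p) + c (P.d p) := fun _ => rfl
  have hHC : ∀ p, H p ∈ C.toSub := fun p => add_mem (C.d_mem _ (hcC p)) (hcC _)
  have hHb : ∀ x, H (b (.inr x)) = b (.inr x) := by
    rintro (x | x)
    · rw [hH, ← hd, hc, hc]
      simp [w]
    · rw [hH, hd, P.d_d, ← hd, hc, map_zero, add_zero]
      exact (hd x).symm
  have hHid : ∀ p ∈ C.toSub, H p = p := by
    intro p hp
    refine LinearMap.eqOn_span (f := H) (g := LinearMap.id) (s := Set.range (b ∘ .inr)) ?_ hp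
    rintro _ ⟨x, rfl⟩
    exact hHb x
  let deg : J ⊕ X ⊕ X → ℤ := Sum.elim degJ (Sum.elim degX fun x => degX x + 1)
  have hdeg : ∀ j, b j ∈ P.gr (deg j) := by
    rintro (j | x | x)
    · exact hJ j
    · exact hX x
    · rw [hd]; exact P.d_mem _ _ (hX x)
  have hwdeg : ∀ j, w j ∈ P.gr (deg j - 1) := by
    rintro (j | x | x)
    · exact zero_mem _
    · exact zero_mem _
    · simpa [w, deg] using hX x
  have hHdeg : ∀ (i : ℤ) (p : P), p ∈ P.gr i → H p ∈ P.gr i := by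
    intro i p hp
    rw [hH]
    refine add_mem ?_ ?_
    · have := P.d_mem _ _ (antilinearExt_mem b w hdeg hwdeg hp)
      rwa [sub_add_cancel] at this
    · have := antilinearExt_mem b w hdeg hwdeg (P.d_mem _ _ hp)
      rwa [add_sub_cancel_right] at this
  have hHd : ∀ p, H (P.d p) = P.d (H p) := by
    intro p
    simp [hH, P.d_d]
  -- `1 - H` vanishes on `C`, so it descends to a section of the projection to `P / C`.
  let sLin : C.quotient →ₗ[A] P := C.toSub.liftQ (LinearMap.id - H) (fun p hp => by
    rw [LinearMap.mem_ker, LinearMap.sub_apply, hHid p hp]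
    exact sub_self p)
  have hs : ∀ p, sLin (C.proj p) = p - H p := fun p => rfl
  let s : DGHom C.quotient P :=
    { toLin := sLin
      map_mem := fun i m hm => by
        obtain ⟨p, hp, rfl⟩ := (C.mem_quotient_gr_iff).1 hm
        rw [hs]
        exact sub_mem hp (hHdeg i p hp)
      comm := fun m => by
        obtain ⟨p, rfl⟩ := C.proj_surjective m
        rw [C.d_proj, hs, hs, map_sub, hHd] }
  have hproj : ∀ j, P.d (b (.inl j)) ∈ Submodule.span A ((b ∘ .inl) '' {i | lev i < lev j}) ⊔
      C.toSub := hdJ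
  have li : LinearIndependent A (C.proj ∘ b ∘ Sum.inl) := by
    rw [linearIndependent_iff]
    intro l hl
    rw [← Finsupp.apply_linearCombination, C.proj_eq_zero_iff] at hl
    change _ ∈ Submodule.span A (Set.range (b ∘ Sum.inr)) at hl
    rw [Set.range_comp, Module.Basis.mem_span_image, ← Finsupp.linearCombination_mapDomain,
      b.repr_linearCombination] at hl
    ext j
    by_contra hj
    have h1 : Sum.inl j ∈ (Finsupp.mapDomain (Sum.inl : J → J ⊕ X ⊕ X) l).support := by
      rw [Finsupp.mem_support_iff, Finsupp.mapDomain_apply Sum.inl_injective]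
      exact hj
    obtain ⟨x, hx⟩ := hl h1
    cases hx
  have sp : ⊤ ≤ Submodule.span A (Set.range (C.proj ∘ b ∘ Sum.inl)) := by
    rintro x -
    obtain ⟨p, rfl⟩ := C.proj_surjective x
    induction p using basis_induction b with
    | zero => rw [map_zero]; exact zero_mem _
    | add x y hx hy => rw [map_add]; exact add_mem hx hy
    | smul a j =>
      rw [map_smul]
      refine Submodule.smul_mem _ _ ?_
      rcases j with j | x
      · exact Submodule.subset_span ⟨j, rfl⟩
      · rw [C.proj_eq_zero_iff.2 (show b (.inr x) ∈ C.toSub from Submodule.subset_span ⟨x, rfl⟩)]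
        exact zero_mem _
  have hbasis : ∀ j, Module.Basis.mk li sp j = C.proj (b (.inl j)) := fun j =>
    Module.Basis.mk_apply _ _ _
  refine ⟨C.quotient,
    { J := J, b := Module.Basis.mk li sp, deg := degJ, lev := lev, lev_le := hlev
      mem := fun j => ?_, d_mem := fun j => ?_ }, s, ?_⟩
  · rw [hbasis]
    exact C.mem_quotient_gr_iff.2 ⟨_, hJ j, rfl⟩
  · rw [hbasis, C.d_proj, Module.Basis.coe_mk]
    obtain ⟨y, hy, z, hz, hyz⟩ := Submodule.mem_sup.1 (hproj j)
    rw [← hyz, map_add, C.proj_eq_zero_iff.2 hz, add_zero, Set.image_comp, Submodule.span_image]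
    exact Submodule.mem_map_of_mem hy
  -- The section followed by the projection is the identity; the other composite is `1 - H = 1 - (d
  -- c + c d)`, so `c` is the required homotopy.
  · refine .of_leftInverse (C.proj.restrictScalars k) (fun p => (C.d_proj p).symm) c
      (fun m => ?_) (fun p => ?_)
    · obtain ⟨p, rfl⟩ := C.proj_surjective m
      change C.proj (sLin (C.proj p)) = _
      rw [hs, map_sub, C.proj_eq_zero_iff.2 (hHC p), sub_zero]
    · change _ = p - sLin (C.proj p)
      rw [hs, sub_sub_cancel, hH]

end DGMod

/-! ### The enveloping algebra and DG bimodules -/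

lemma negOnePow_congr {m n : ℤ} (h : ∃ l, m - n = l + l) : m.negOnePow = n.negOnePow :=
  (Int.negOnePow_eq_iff m n).2 h

namespace DGAlg

variable {k : Type u} [Field k] (A : DGAlg k)

/-- The linear identification of `A ⊗ A` with `A^e`. -/
def envEquiv : A ⊗[k] A ≃ₗ[k] A.env :=
  (TensorProduct.congr (LinearEquiv.refl k A) A.toOp).trans
    (GradedTensorProduct.of k A.gr A.op.gr)

/-- The element `a ⊗ b` of `A^e`. -/
def envTmul : A →ₗ[k] A →ₗ[k] A.env := TensorProduct.curry A.envEquiv.toLinearMap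

variable {A}

lemma envEquiv_tmul (a b : A) : A.envEquiv (a ⊗ₜ b) = A.envTmul a b := rfl

lemma envTmul_one_one : A.envTmul 1 1 = 1 := rfl

lemma envTmul_mul {j i' : ℤ} (a : A) {b a' : A} (b' : A) (hb : b ∈ A.gr j) (ha' : a' ∈ A.gr i') :
    A.envTmul a b * A.envTmul a' b' = (j * i').negOnePow • A.envTmul (a * a') (A.opMul b b') :=
  mul_tmul (A := A) (B := A.op) a b' hb ha'

lemma envTmul_mem {i j : ℤ} {a b : A} (ha : a ∈ A.gr i) (hb : b ∈ A.gr j) :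
    A.envTmul a b ∈ A.env.gr (i + j) :=
  tmul_mem (A := A) (B := A.op) ha hb rfl

lemma d_envTmul {i : ℤ} {a : A} (b : A) (ha : a ∈ A.gr i) :
    A.env.d (A.envTmul a b) = A.envTmul (A.d a) b + i.negOnePow • A.envTmul a (A.d b) :=
  tensorD_tmul (A := A) (B := A.op) b ha

lemma env_induction {p : A.env → Prop} (x : A.env) (zero : p 0)
    (add : ∀ x y, p x → p y → p (x + y))
    (tmul : ∀ (i j : ℤ) (a b : A), a ∈ A.gr i → b ∈ A.gr j → p (A.envTmul a b)) : p x :=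
  tensor_induction (A := A) (B := A.op) x zero add tmul

lemma envTmul_left_mul (a a' b : A) : A.envTmul a 1 * A.envTmul a' b = A.envTmul (a * a') b := by
  induction a' using Decomposition.inductionOn A.gr with
  | zero => simp
  | add a a' h h' => simp only [map_add, LinearMap.add_apply, mul_add, h, h']
  | @homogeneous i a' =>
    rw [envTmul_mul a b (SetLike.one_mem_graded A.gr) a'.2, A.one_opMul]
    simp

variable (A) in
/-- The ring homomorphism `a ↦ a ⊗ 1` from `A` to `A^e`. -/
def envLeft : A →+* A.env where
  toFun a := A.envTmul a 1
  map_one' := rfl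
  map_mul' a b := (envTmul_left_mul a b 1).symm
  map_zero' := by simp
  map_add' := by simp

lemma envTmul_right_mul_left {i j : ℤ} {a b : A} (ha : a ∈ A.gr i) (hb : b ∈ A.gr j) :
    A.envTmul 1 b * A.envTmul a 1 = (j * i).negOnePow • A.envTmul a b := by
  rw [envTmul_mul 1 1 hb ha, A.opMul_one, one_mul]

lemma envTmul_right_mul {i j : ℤ} {a b : A} (ha : a ∈ A.gr i) (hb : b ∈ A.gr j) :
    A.envTmul 1 b * A.envTmul 1 a = (j * i).negOnePow • A.envTmul 1 (a * b) := by
  rw [envTmul_mul 1 a hb (SetLike.one_mem_graded A.gr), opMul_apply A hb ha, map_sign]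
  simp

lemma d_one (A : DGAlg k) : A.d 1 = 0 := by
  have := A.leibniz 0 1 1 (SetLike.one_mem_graded A.gr)
  simpa using this

end DGAlg

/-- A DG bimodule over `A`: a left DG module with a compatible right action. -/
structure DGBimod {k : Type u} [Field k] (A : DGAlg k) where
  left : DGMod A
  r : left →ₗ[k] A →ₗ[k] left
  r_one : ∀ f, r f 1 = f
  r_r : ∀ f a b, r (r f a) b = r f (a * b)
  r_smul : ∀ (a : A) f b, r (a • f) b = a • r f b
  r_mem : ∀ (i j : ℤ) f b, f ∈ left.gr i → b ∈ A.gr j → r f b ∈ left.gr (i + j)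
  d_r : ∀ (i : ℤ) f b, f ∈ left.gr i → left.d (r f b) = r (left.d f) b + i.negOnePow • r f (A.d b)

namespace DGBimod

variable {k : Type u} [Field k] {A : DGAlg k}

/-- A basis of a DG bimodule that defines a semi-free filtration with levels `0, …, n`. -/
structure SemiBasis (F : DGBimod A) (n : ℕ) where
  J : Type u
  y : J → F.left
  equiv : (J →₀ A ⊗[k] A) ≃ₗ[k] F.left
  equiv_single : ∀ j a b, equiv (Finsupp.single j (a ⊗ₜ b)) = F.r (a • y j) b
  deg : J → ℤ
  mem : ∀ j, y j ∈ F.left.gr (deg j)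
  lev : J → ℕ
  lev_le : ∀ j, lev j ≤ n
  d_mem : ∀ j, F.left.d (y j) ∈ Submodule.span k 
    {x | ∃ (i : J) (a b : A), lev i < lev j ∧ x = F.r (a • y i) b}

end DGBimod

/-! ### DG modules over the enveloping algebra as DG bimodules -/

namespace DGMod

variable {k : Type u} [Field k] {A : DGAlg k} (F : DGMod A.env)

/-- The DG `A`-module underlying a DG `A^e`-module. -/
def leftOfEnv : DGMod A :=
  letI : Module A F.carrier := Module.compHom F.carrier (DGAlg.envLeft A)
  { carrier := F.carrier
    tower := ⟨fun c a f => by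
      change A.envTmul (c • a) 1 • f = c • A.envTmul a 1 • f
      rw [map_smul, LinearMap.smul_apply, smul_assoc]⟩
    gr := F.gr
    smul_mem := fun i j a f ha hf => F.smul_mem i j (A.envTmul a 1) f
      (by simpa using DGAlg.envTmul_mem ha (SetLike.one_mem_graded A.gr)) hf
    d := F.d
    d_mem := F.d_mem
    d_d := F.d_d
    leibniz := fun i a f ha => by
      refine (F.leibniz i (A.envTmul a 1) f
        (by simpa using DGAlg.envTmul_mem ha (SetLike.one_mem_graded A.gr))).trans ?_
      rw [DGAlg.d_envTmul 1 ha, A.d_one, map_zero, smul_zero, add_zero]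
      rfl }

/-- The action of the elements `1 ⊗ b`. -/
def envRight : A →ₗ[k] Module.End k F :=
  (Algebra.lsmul k k F).toLinearMap ∘ₗ A.envTmul 1

/-- The right action `f b = (-1)^(|b||f|) (1 ⊗ b) f`. -/
def rightOfEnv : A →ₗ[k] Module.End k F :=
  DirectSum.toModule k ℤ (Module.End k F) (fun i =>
    LinearMap.mulRight k (gradedSign F.gr i : Module.End k F) ∘ₗ F.envRight ∘ₗ (A.gr i).subtype) ∘ₗ
    (decomposeLinearEquiv A.gr).toLinearMap

lemma rightOfEnv_apply {i j : ℤ} {f : F} {b : A} (hf : f ∈ F.gr i) (hb : b ∈ A.gr j) :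
    F.rightOfEnv b f = (j * i).negOnePow • A.envTmul 1 b • f := by
  lift b to A.gr j using hb
  simp only [rightOfEnv, LinearMap.comp_apply, LinearEquiv.coe_coe, decomposeLinearEquiv_apply_coe]
  rw [DirectSum.toModule_lof]
  change A.envTmul 1 b • gradedSign F.gr j f = _
  rw [gradedSign_apply F.gr j hf, smul_sign]

lemma rightOfEnv_one (f : F) : F.rightOfEnv 1 f = f := by
  induction f using Decomposition.inductionOn F.gr with
  | zero => simp
  | add a a' h h' => simp only [map_add, h, h']
  | homogeneous f =>
    rw [rightOfEnv_apply F f.2 (SetLike.one_mem_graded A.gr), DGAlg.envTmul_one_one]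
    simp

lemma rightOfEnv_mem {i j : ℤ} {f : F} {b : A} (hf : f ∈ F.gr i) (hb : b ∈ A.gr j) :
    F.rightOfEnv b f ∈ F.gr (i + j) := by
  rw [rightOfEnv_apply F hf hb]
  have := F.smul_mem _ _ _ f (DGAlg.envTmul_mem (SetLike.one_mem_graded A.gr) hb) hf
  rw [zero_add, add_comm] at this
  exact DGAlg.sign_mem _ _ this

/-- The factor `(-1)^(|a||b|)` occurs twice, once from the multiplication of `A^op` and once because
`b` also passes `a` in `f a`. The two cancel, which leaves an unsigned right action. -/
lemma rightOfEnv_mul (a b : A) (f : F) :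
    F.rightOfEnv b (F.rightOfEnv a f) = F.rightOfEnv (a * b) f := by
  induction f using Decomposition.inductionOn F.gr with
  | zero => simp
  | add a a' h h' => simp only [map_add, h, h']
  | @homogeneous i f =>
  induction a using Decomposition.inductionOn A.gr with
  | zero => simp
  | add a a' h h' => simp only [map_add, add_mul, LinearMap.add_apply, h, h']
  | @homogeneous j a =>
  induction b using Decomposition.inductionOn A.gr with
  | zero => simp
  | add a a' h h' => simp only [map_add, mul_add, LinearMap.add_apply, h, h']
  | @homogeneous l b =>
  rw [rightOfEnv_apply F (rightOfEnv_mem F f.2 a.2) b.2, rightOfEnv_apply F f.2 a.2,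
    rightOfEnv_apply F f.2 (SetLike.mul_mem_graded a.2 b.2), smul_sign, smul_smul, ← mul_smul,
    DGAlg.envTmul_right_mul a.2 b.2, sign_smul, smul_smul, ← Int.negOnePow_add,
    ← Int.negOnePow_add]
  congr 1
  exact negOnePow_congr ⟨l * j, by ring⟩

lemma rightOfEnv_smul (a b : A) (f : F) :
    F.rightOfEnv b (A.envTmul a 1 • f) = A.envTmul a 1 • F.rightOfEnv b f := by
  induction f using Decomposition.inductionOn F.gr with
  | zero => simp
  | add a a' h h' => simp only [map_add, smul_add, h, h']
  | @homogeneous i f =>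
  induction a using Decomposition.inductionOn A.gr with
  | zero => simp
  | add a a' h h' => simp only [map_add, add_smul, LinearMap.add_apply, h, h']
  | @homogeneous j a =>
  induction b using Decomposition.inductionOn A.gr with
  | zero => simp
  | add a a' h h' => simp only [map_add, smul_add, LinearMap.add_apply, h, h']
  | @homogeneous l b =>
  have h1 : A.envTmul (a : A) 1 • (f : F) ∈ F.gr (j + i) := F.smul_mem _ _ _ _
    (by simpa using DGAlg.envTmul_mem a.2 (SetLike.one_mem_graded A.gr)) f.2
  rw [rightOfEnv_apply F h1 b.2, rightOfEnv_apply F f.2 b.2, smul_sign, ← mul_smul, ← mul_smul,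
    DGAlg.envTmul_right_mul_left a.2 b.2, DGAlg.envTmul_left_mul, mul_one, sign_smul, smul_smul,
    ← Int.negOnePow_add]
  congr 1
  exact negOnePow_congr ⟨l * j, by ring⟩

lemma d_rightOfEnv {i : ℤ} {f : F} (hf : f ∈ F.gr i) (b : A) :
    F.d (F.rightOfEnv b f) = F.rightOfEnv b (F.d f) + i.negOnePow • F.rightOfEnv (A.d b) f := by
  induction b using Decomposition.inductionOn A.gr with
  | zero => simp
  | add a a' h h' => simp only [map_add, smul_add, LinearMap.add_apply, h, h']; abel
  | @homogeneous l b =>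
  have hm := DGAlg.envTmul_mem (SetLike.one_mem_graded A.gr) b.2
  rw [zero_add] at hm
  rw [rightOfEnv_apply F hf b.2, rightOfEnv_apply F (F.d_mem _ _ hf) b.2,
    rightOfEnv_apply F hf (A.d_mem _ _ b.2), DGAlg.map_sign, F.leibniz _ _ _ hm,
    DGAlg.d_envTmul _ (SetLike.one_mem_graded A.gr), A.d_one, map_zero, LinearMap.zero_apply,
    zero_add, Int.negOnePow_zero, one_smul, smul_add, smul_smul, smul_smul, ← Int.negOnePow_add,
    ← Int.negOnePow_add, add_comm]
  congr 2
  · congr 1; ring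
  · exact negOnePow_congr ⟨-i, by ring⟩

/-- The DG bimodule underlying a DG `A^e`-module. -/
def bimodOfEnv : DGBimod A where
  left := F.leftOfEnv
  r := F.rightOfEnv.flip
  r_one := F.rightOfEnv_one
  r_r f a b := F.rightOfEnv_mul a b f
  r_smul a f b := F.rightOfEnv_smul a b f
  r_mem _ _ _ _ hf hb := F.rightOfEnv_mem hf hb
  d_r _ _ b hf := F.d_rightOfEnv hf b

variable {F}

/-- Since `a y b` and `(a ⊗ b) y` differ only by a sign, a basis over `A^e` is also a basis as a
bimodule; `bimodInv` corrects that sign. -/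
lemma rightOfEnv_envTmul {i j : ℤ} {y : F} {b : A} (a : A) (hy : y ∈ F.gr i) (hb : b ∈ A.gr j) :
    F.rightOfEnv b (A.envTmul a 1 • y) = (j * i).negOnePow • A.envTmul a b • y := by
  rw [rightOfEnv_smul, rightOfEnv_apply F hy hb, smul_sign, ← mul_smul, DGAlg.envTmul_left_mul,
    mul_one]

namespace SemiBasis

variable {n : ℕ} (B : F.SemiBasis n)

/-- The map `⨁ A ⊗ A → F` that sends `a ⊗ b` in the `j`-th summand to `a y_j b`. -/
def bimodMap : (B.J →₀ A ⊗[k] A) →ₗ[k] F :=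
  Finsupp.lsum k fun j => TensorProduct.lift
    (F.rightOfEnv.flip ∘ₗ (LinearMap.toSpanSingleton A.env F (B.b j)).restrictScalars k ∘ₗ
      A.envTmul.flip 1)

/-- The inverse of `bimodMap`. -/
def bimodInv : F →ₗ[k] (B.J →₀ A ⊗[k] A) :=
  (Finsupp.lsum k fun j => Finsupp.lsingle j ∘ₗ (gradedSign A.gr (B.deg j)).lTensor A ∘ₗ
    A.envEquiv.symm.toLinearMap) ∘ₗ B.b.repr.toLinearMap.restrictScalars k

lemma bimodMap_single (j : B.J) (a b : A) :
    B.bimodMap (Finsupp.single j (a ⊗ₜ b)) = F.rightOfEnv b (A.envTmul a 1 • B.b j) := by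
  simp [bimodMap]

lemma bimodInv_envTmul (j : B.J) (a b : A) :
    B.bimodInv (A.envTmul a b • B.b j) =
      Finsupp.single j (a ⊗ₜ gradedSign A.gr (B.deg j) b) := by
  rw [← DGAlg.envEquiv_tmul]
  simp [bimodInv]

lemma bimodMap_bimodInv (f : F) : B.bimodMap (B.bimodInv f) = f := by
  induction f using basis_induction B.b with
  | zero => simp
  | add x y hx hy => rw [map_add, map_add, hx, hy]
  | smul x j =>
    induction x using DGAlg.env_induction with
    | zero => simp
    | add x y hx hy => rw [add_smul, map_add, map_add, hx, hy]
    | tmul i l a b ha hb =>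
      rw [bimodInv_envTmul, gradedSign_apply _ _ hb, bimodMap_single, DGAlg.map_sign]
      change (_ • F.rightOfEnv b) _ = _
      rw [LinearMap.smul_apply, rightOfEnv_envTmul a (B.mem j) hb, smul_smul,
        ← Int.negOnePow_add, Int.negOnePow_even _ ⟨l * B.deg j, by ring⟩, one_smul]

lemma bimodInv_bimodMap (x : B.J →₀ A ⊗[k] A) : B.bimodInv (B.bimodMap x) = x := by
  induction x using Finsupp.induction_linear with
  | zero => simp
  | add x y hx hy => rw [map_add, map_add, hx, hy]
  | single j t =>
    induction t using TensorProduct.induction_on with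
    | zero => simp
    | add x y hx hy => rw [Finsupp.single_add, map_add, map_add, hx, hy]
    | tmul a b =>
      induction b using Decomposition.inductionOn A.gr with
      | zero => simp
      | add x y hx hy => rw [tmul_add, Finsupp.single_add, map_add, map_add, hx, hy]
      | @homogeneous l b =>
        rw [bimodMap_single, rightOfEnv_envTmul a (B.mem j) b.2, DGAlg.map_sign,
          bimodInv_envTmul, gradedSign_apply _ _ b.2]
        rcases Int.units_eq_one_or (l * B.deg j).negOnePow with h | h <;>
          rw [mul_comm (B.deg j), h] <;> simp [TensorProduct.tmul_neg]

/-- A semi-free basis over `A^e`, as a basis of the underlying bimodule. -/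
def toBimod : F.bimodOfEnv.SemiBasis n where
  J := B.J
  y := B.b
  equiv := LinearEquiv.ofLinearMap B.bimodMap B.bimodInv (LinearMap.ext B.bimodMap_bimodInv)
    (LinearMap.ext B.bimodInv_bimodMap)
  equiv_single := B.bimodMap_single
  deg := B.deg
  mem := B.mem
  lev := B.lev
  lev_le := B.lev_le
  d_mem j := by
    have := B.d_mem j
    change F.d (B.b j) ∈ Submodule.span k {x | ∃ i a b, B.lev i < B.lev j ∧
      x = F.rightOfEnv b (A.envTmul a 1 • B.b i)}
    generalize F.d (B.b j) = z at this ⊢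
    induction this using Submodule.closure_induction with
    | zero => exact zero_mem _
    | add x y _ _ hx hy => exact add_mem hx hy
    | smul_mem x y hy =>
      obtain ⟨i, hi, rfl⟩ := hy
      induction x using DGAlg.env_induction with
      | zero => rw [zero_smul]; exact zero_mem _
      | add x y hx hy => rw [add_smul]; exact add_mem hx hy
      | tmul l m a b ha hb =>
        have h := rightOfEnv_envTmul a (B.mem i) hb
        have h' : A.envTmul a b • B.b i = (m * B.deg i).negOnePow •
            F.rightOfEnv b (A.envTmul a 1 • B.b i) := by
          rw [h, smul_smul, ← Int.negOnePow_add,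
            Int.negOnePow_even _ ⟨m * B.deg i, by ring⟩, one_smul]
        rw [h']
        exact DGAlg.sign_mem _ _ (Submodule.subset_span ⟨i, a, b, hi, rfl⟩)

end SemiBasis

end DGMod

/-! ### Splitting and contracting complexes over a field -/

lemma eq_zero_of_mem_span_of_linearIndependent {K V W ι : Type*} [Ring K] [AddCommGroup V]
    [Module K V] [AddCommGroup W] [Module K W] (T : V →ₗ[K] W) {v : ι → V}
    (h : LinearIndependent K (T ∘ v)) {x : V} (hx : x ∈ Submodule.span K (Set.range v))
    (hT : T x = 0) : x = 0 := by
  rw [Finsupp.mem_span_range_iff_exists_finsupp] at hx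
  obtain ⟨l, rfl⟩ := hx
  have : Finsupp.linearCombination K (T ∘ v) l = 0 := by
    rw [← Finsupp.apply_linearCombination]
    exact hT
  rw [linearIndependent_iff.1 h l this, Finsupp.sum_zero_index]

namespace DGAlg

variable {k : Type u} [Field k] (A : DGAlg k)

lemma sgn_sgn (a : A) : A.sgn (A.sgn a) = a := by
  induction a using Decomposition.inductionOn A.gr with
  | zero => simp
  | add a a' h h' => simp only [map_add, h, h']
  | @homogeneous i a =>
  rw [A.sgn_apply a.2, map_sign, A.sgn_apply a.2]
  rcases Int.units_eq_one_or i.negOnePow with h | h <;> rw [h] <;> simp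

lemma sgn_d (a : A) : A.sgn (A.d a) = -A.d (A.sgn a) := by
  induction a using Decomposition.inductionOn A.gr with
  | zero => simp
  | add a a' h h' => simp only [map_add, h, h', neg_add]
  | @homogeneous i a =>
  rw [A.sgn_apply a.2, map_sign, A.sgn_apply (A.d_mem _ _ a.2), Int.negOnePow_succ, Units.neg_smul]

end DGAlg

namespace DGMod

variable {k : Type u} [Field k] {A : DGAlg k} (M : DGMod A)

/-- The sign involution `m ↦ (-1)^|m| m`. -/
def sgn : M →ₗ[k] M := gradedSign M.gr 1

variable {M}

lemma sgn_apply {i : ℤ} {m : M} (hm : m ∈ M.gr i) : M.sgn m = i.negOnePow • m := by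
  rw [sgn, gradedSign_apply M.gr 1 hm, one_mul]

lemma sgn_sgn (m : M) : M.sgn (M.sgn m) = m := gradedSign_gradedSign _ _ _

lemma sgn_smul (a : A) (m : M) : M.sgn (a • m) = A.sgn a • M.sgn m := by
  induction a using Decomposition.inductionOn A.gr with
  | zero => simp
  | add a a' h h' => simp only [map_add, add_smul, h, h']
  | @homogeneous i a =>
  induction m using Decomposition.inductionOn M.gr with
  | zero => simp
  | add a a' h h' => simp only [map_add, smul_add, h, h']
  | @homogeneous j m =>
  rw [A.sgn_apply a.2, sgn_apply m.2, sgn_apply (M.smul_mem _ _ _ _ a.2 m.2), sign_smul, smul_sign,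
    smul_smul, Int.negOnePow_add]

lemma sgn_d (m : M) : M.sgn (M.d m) = -M.d (M.sgn m) := by
  induction m using Decomposition.inductionOn M.gr with
  | zero => simp
  | add a a' h h' => simp only [map_add, h, h', neg_add]
  | @homogeneous i m =>
  rw [sgn_apply m.2, DGAlg.map_sign, sgn_apply (M.d_mem _ _ m.2), Int.negOnePow_succ,
    Units.neg_smul]

lemma d_smul (a : A) (m : M) : M.d (a • m) = A.d a • m + A.sgn a • M.d m := by
  induction a using Decomposition.inductionOn A.gr with
  | zero => simp
  | add a a' h h' => simp only [map_add, add_smul, h, h']; abel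
  | @homogeneous i a => rw [M.leibniz _ _ _ a.2, A.sgn_apply a.2, sign_smul]

variable (M) in
/-- A complex of vector spaces has a homogeneous basis that consists of cocycles `h` and of pairs
`x, d x`. -/
theorem exists_split_basis : ∃ (I X : Type u) (b : Module.Basis (I ⊕ X ⊕ X) k M) (degI : I → ℤ)
    (degX : X → ℤ), (∀ i, b (.inl i) ∈ M.gr (degI i)) ∧ (∀ i, M.d (b (.inl i)) = 0) ∧
      (∀ x, b (.inr (.inl x)) ∈ M.gr (degX x)) ∧
      ∀ x, b (.inr (.inr x)) = M.d (b (.inr (.inl x))) := by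
  classical
  -- Choose homogeneous `x` whose differentials form a basis of the boundaries.
  obtain ⟨X, x, -, hx, hxi⟩ := exists_linearIndependent' k
    (fun v : {v : M // ∃ j, v ∈ M.gr j} => M.d v)
  -- Choose homogeneous cocycles whose classes modulo boundaries form a basis of the cohomology.
  obtain ⟨I, h, -, hh, hhi⟩ := exists_linearIndependent' k
    (fun v : {v : M // (∃ j, v ∈ M.gr j) ∧ M.d v = 0} => (LinearMap.range M.d).mkQ v)
  let X' : X → M := fun i => x i
  let I' : I → M := fun i => h i
  have hxi' : LinearIndependent k (M.d ∘ X') := hxi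
  have hhi' : LinearIndependent k ((LinearMap.range M.d).mkQ ∘ I') := hhi
  have hdX : LinearMap.range M.d ≤ Submodule.span k (Set.range (M.d ∘ X')) := by
    rintro _ ⟨v, rfl⟩
    change M.d v ∈ Submodule.span k (Set.range ((fun v : {v : M // ∃ j, v ∈ M.gr j} => M.d v) ∘ x))
    rw [hx, ← sum_support_decompose M.gr v, map_sum]
    exact Submodule.sum_mem _ fun i _ => Submodule.subset_span
      ⟨⟨_, i, (decompose M.gr v i).2⟩, rfl⟩
  have hdX' : Submodule.span k (Set.range (M.d ∘ X')) ≤ LinearMap.range M.d := by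
    rw [Submodule.span_le]
    rintro _ ⟨i, rfl⟩
    exact ⟨_, rfl⟩
  have hdd : ∀ v ∈ LinearMap.range M.d, M.d v = 0 := by
    rintro _ ⟨v, rfl⟩
    exact M.d_d v
  have dis1 : Disjoint (Submodule.span k (Set.range X')) (Submodule.span k (Set.range (M.d ∘ X'))) := by
    rw [Submodule.disjoint_def]
    exact fun v hv hv' => eq_zero_of_mem_span_of_linearIndependent M.d hxi' hv (hdd v (hdX' hv'))
  have dis2 : Disjoint (Submodule.span k (Set.range I'))
      (Submodule.span k (Set.range (Sum.elim X' (M.d ∘ X')))) := by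
    rw [Submodule.disjoint_def]
    intro v hv hv'
    refine eq_zero_of_mem_span_of_linearIndependent _ hhi' hv ?_
    have hdv : M.d v = 0 := by
      refine Submodule.span_le (p := LinearMap.ker M.d).2 ?_ hv
      rintro _ ⟨i, rfl⟩
      exact (h i).2.2
    rw [Set.Sum.elim_range, Submodule.span_union] at hv'
    obtain ⟨y, hy, z, hz, rfl⟩ := Submodule.mem_sup.1 hv'
    rw [map_add, hdd z (hdX' hz), add_zero] at hdv
    rw [eq_zero_of_mem_span_of_linearIndependent M.d hxi' hy hdv, zero_add]
    exact (Submodule.Quotient.mk_eq_zero _).2 (hdX' hz)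
  have li : LinearIndependent k (Sum.elim I' (Sum.elim X' (M.d ∘ X'))) :=
    (LinearIndependent.of_comp _ hhi').sum_type
      ((LinearIndependent.of_comp _ hxi').sum_type hxi' dis1) dis2
  have sp : ⊤ ≤ Submodule.span k (Set.range (Sum.elim I' (Sum.elim X' (M.d ∘ X')))) := by
    rintro m -
    rw [Set.Sum.elim_range, Set.Sum.elim_range, Submodule.span_union, Submodule.span_union]
    -- Subtracting a combination `u` of the `x` makes `m` a cocycle; subtracting a combination `w`
    -- of the chosen cocycles then makes it a boundary.
    obtain ⟨u, hu, hdu⟩ : ∃ u ∈ Submodule.span k (Set.range X'), M.d u = M.d m := by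
      have := hdX ⟨m, rfl⟩
      rwa [Set.range_comp, Submodule.span_image] at this
    have hz : ∀ z, M.d z = 0 → (LinearMap.range M.d).mkQ z ∈
        Submodule.span k (Set.range ((LinearMap.range M.d).mkQ ∘ I')) := by
      intro z hz
      change _ ∈ Submodule.span k (Set.range ((fun v : {v : M // (∃ j, v ∈ M.gr j) ∧ M.d v = 0} =>
        (LinearMap.range M.d).mkQ v) ∘ h))
      rw [hh, ← sum_support_decompose M.gr z, map_sum]
      refine Submodule.sum_mem _ fun i _ => Submodule.subset_span
        ⟨⟨_, ⟨i, (decompose M.gr z i).2⟩, ?_⟩, rfl⟩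
      rw [← decompose_d_apply, hz]
      simp
    have h1 := hz (m - u) (by rw [map_sub, hdu, sub_self])
    rw [Set.range_comp, Submodule.span_image] at h1
    obtain ⟨w, hw, hwm⟩ := h1
    have h2 : m - u - w ∈ LinearMap.range M.d := by
      rw [← Submodule.Quotient.mk_eq_zero, ← Submodule.mkQ_apply, map_sub, hwm, sub_self]
    rw [show m = w + (u + (m - u - w)) by abel]
    exact Submodule.add_mem_sup hw (Submodule.add_mem_sup hu (hdX h2))
  have hb := Module.Basis.coe_mk li sp
  refine ⟨I, X, Module.Basis.mk li sp, fun i => (h i).2.1.choose, fun i => (x i).2.choose,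
    fun i => ?_, fun i => ?_, fun i => ?_, fun i => ?_⟩ <;> simp only [hb]
  · exact (h i).2.1.choose_spec
  · exact (h i).2.2
  · exact (x i).2.choose_spec
  · rfl

/-- An acyclic complex of vector spaces is contractible. -/
theorem exists_contraction (hM : ∀ m, M.d m = 0 → ∃ m', M.d m' = m) :
    ∃ c : M →ₗ[k] M, (∀ m, M.d (c m) + c (M.d m) = m) ∧ ∀ m, c (M.sgn m) = -M.sgn (c m) := by
  obtain ⟨I, X, b, degI, degX, -, hI, hX, hd⟩ := M.exists_split_basis
  -- In an acyclic complex a basis cocycle `b i` would be a boundary, hence a combination of the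
  -- other basis elements `d x`, which is impossible. Only the pairs remain.
  have hI' : IsEmpty I := by
    refine ⟨fun i => ?_⟩
    obtain ⟨w, hw⟩ := hM _ (hI i)
    have hr : ∀ w, M.d w ∈ Submodule.span k (b '' Set.range fun x => .inr (.inr x)) := by
      intro w
      refine Submodule.span_le (p := Submodule.comap M.d
        (Submodule.span k (b '' Set.range fun x => .inr (.inr x)))).2 ?_
        (b.span_eq ▸ Submodule.mem_top : w ∈ Submodule.span k (Set.range b))
      rintro _ ⟨i | x | x, rfl⟩
      · rw [SetLike.mem_coe, Submodule.mem_comap, hI]; exact zero_mem _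
      · rw [SetLike.mem_coe, Submodule.mem_comap, ← hd]
        exact Submodule.subset_span ⟨_, ⟨x, rfl⟩, rfl⟩
      · rw [SetLike.mem_coe, Submodule.mem_comap, hd, M.d_d]; exact zero_mem _
    have := hr w
    rw [hw, Module.Basis.mem_span_image, b.repr_self] at this
    have h1 := this (show Sum.inl i ∈ (Finsupp.single (Sum.inl i : I ⊕ X ⊕ X) (1 : k)).support by
      simp)
    obtain ⟨x, hx⟩ := h1
    cases hx
  let c : M →ₗ[k] M := b.constr k (Sum.elim (fun _ => 0)
    (Sum.elim (fun _ => 0) fun x => b (.inr (.inl x))))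
  have hc1 : ∀ x, c (b (.inr (.inl x))) = 0 := fun x => by simp [c]
  have hc2 : ∀ x, c (b (.inr (.inr x))) = b (.inr (.inl x)) := fun x => by simp [c]
  refine ⟨c, fun m => ?_, fun m => ?_⟩
  · refine LinearMap.congr_fun (f := M.d ∘ₗ c + c ∘ₗ M.d) (g := LinearMap.id) (b.ext ?_) m
    rintro (i | x | x)
    · exact isEmptyElim i
    · simp [hc1, ← hd, hc2]
    · simp only [LinearMap.add_apply, LinearMap.comp_apply, hc2, LinearMap.id_apply]
      rw [hd, M.d_d, map_zero, add_zero]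
  · refine LinearMap.congr_fun (f := c ∘ₗ M.sgn) (g := -(M.sgn ∘ₗ c)) (b.ext ?_) m
    rintro (i | x | x)
    · exact isEmptyElim i
    · simp only [LinearMap.comp_apply, LinearMap.neg_apply]
      rw [sgn_apply (hX x), DGAlg.map_sign, hc1, map_zero, neg_zero, smul_zero]
    · have hX' : b (.inr (.inr x)) ∈ M.gr (degX x + 1) := by
        rw [hd]; exact M.d_mem _ _ (hX x)
      simp only [LinearMap.comp_apply, LinearMap.neg_apply]
      rw [sgn_apply hX', DGAlg.map_sign, hc2, sgn_apply (hX x), Int.negOnePow_succ, Units.neg_smul]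

end DGMod

/-! ### Right linear homotopies on semi-free bimodules -/

namespace DGBimod

variable {k : Type u} [Field k] {A : DGAlg k} {F : DGBimod A} {n : ℕ}

lemma sgn_r (f : F.left) (b : A) : F.left.sgn (F.r f b) = F.r (F.left.sgn f) (A.sgn b) := by
  induction f using Decomposition.inductionOn F.left.gr with
  | zero => simp
  | add a a' h h' => simp only [map_add, LinearMap.add_apply, h, h']
  | @homogeneous i f =>
  induction b using Decomposition.inductionOn A.gr with
  | zero => simp
  | add a a' h h' => simp only [map_add, h, h']
  | @homogeneous j b =>
  rw [A.sgn_apply b.2, DGMod.sgn_apply f.2, DGMod.sgn_apply (F.r_mem _ _ _ _ f.2 b.2),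
    DGAlg.map_sign, DGAlg.map_sign, Int.negOnePow_add, mul_comm, mul_smul]
  rfl

lemma d_r' (f : F.left) (b : A) :
    F.left.d (F.r f b) = F.r (F.left.d f) b + F.r (F.left.sgn f) (A.d b) := by
  induction f using Decomposition.inductionOn F.left.gr with
  | zero => simp
  | add a a' h h' => simp only [map_add, LinearMap.add_apply, h, h']; abel
  | @homogeneous i f =>
  rw [F.d_r i f b f.2, DGMod.sgn_apply f.2, DGAlg.map_sign]
  rfl

namespace SemiBasis

variable (B : F.SemiBasis n)

lemma induction {p : F.left → Prop} (f : F.left) (zero : p 0) (add : ∀ f g, p f → p g → p (f + g))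
    (r : ∀ j (a b : A), p (F.r (a • B.y j) b)) : p f := by
  obtain ⟨x, rfl⟩ := B.equiv.surjective f
  induction x using Finsupp.induction_linear with
  | zero => rwa [map_zero]
  | add x y hx hy => rw [map_add]; exact add _ _ hx hy
  | single j t =>
    induction t using TensorProduct.induction_on with
    | zero => rwa [Finsupp.single_zero, map_zero]
    | add x y hx hy => rw [Finsupp.single_add, map_add]; exact add _ _ hx hy
    | tmul a b => rw [B.equiv_single]; exact r j a b

/-- The right linear map with prescribed values on the elements `a y_j`. -/
def rightExt (η : B.J → A →ₗ[k] F.left) : F.left →ₗ[k] F.left :=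
  (Finsupp.lsum k fun j => TensorProduct.lift (F.r ∘ₗ η j)) ∘ₗ B.equiv.symm.toLinearMap

variable (η : B.J → A →ₗ[k] F.left)

lemma rightExt_apply (j : B.J) (a b : A) :
    B.rightExt η (F.r (a • B.y j) b) = F.r (η j a) b := by
  rw [← B.equiv_single]
  simp [rightExt]

lemma rightExt_smul (j : B.J) (a : A) : B.rightExt η (a • B.y j) = η j a := by
  have := B.rightExt_apply η j a 1
  rwa [F.r_one, F.r_one] at this

lemma rightExt_r (f : F.left) (b : A) : B.rightExt η (F.r f b) = F.r (B.rightExt η f) b := by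
  induction f using B.induction with
  | zero => simp
  | add f g hf hg => simp only [map_add, LinearMap.add_apply, hf, hg]
  | r j a b' => rw [F.r_r, rightExt_apply, rightExt_apply, F.r_r]

/-- The span of the elements `a y_j b` of level less than `N`. -/
def levelSpan (N : ℕ) : Submodule k F.left :=
  Submodule.span k {x | ∃ (i : B.J) (a b : A), B.lev i < N ∧ x = F.r (a • B.y i) b}

lemma smul_mem_levelSpan {N : ℕ} (a : A) {f : F.left} (hf : f ∈ B.levelSpan N) :
    a • f ∈ B.levelSpan N := by
  induction hf using Submodule.span_induction with
  | zero => rw [smul_zero]; exact zero_mem _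
  | add x y _ _ hx hy => rw [smul_add]; exact add_mem hx hy
  | smul c x _ hx => rw [smul_comm]; exact Submodule.smul_mem _ _ hx
  | mem x hx =>
    obtain ⟨i, a', b, hi, rfl⟩ := hx
    exact Submodule.subset_span ⟨i, a * a', b, hi, by rw [← F.r_smul, mul_smul]⟩

/-- Values assigned at level `N` do not disturb what was fixed below, which makes recursion over the
levels possible. -/
lemma rightExt_congr {η η' : B.J → A →ₗ[k] F.left} {N : ℕ} (h : ∀ j, B.lev j < N → η j = η' j)
    {f : F.left} (hf : f ∈ B.levelSpan N) : B.rightExt η f = B.rightExt η' f := by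
  refine LinearMap.eqOn_span ?_ hf
  rintro _ ⟨i, a, b, hi, rfl⟩
  rw [rightExt_apply, rightExt_apply, h i hi]

lemma rightExt_sgn (hη : ∀ j a, (B.deg j).negOnePow • η j (A.sgn a) = -F.left.sgn (η j a))
    (f : F.left) : B.rightExt η (F.left.sgn f) = -F.left.sgn (B.rightExt η f) := by
  induction f using B.induction with
  | zero => simp
  | add f g hf hg => simp only [map_add, hf, hg, neg_add]
  | r j a b =>
    rw [sgn_r, rightExt_r, DGMod.sgn_smul, DGMod.sgn_apply (B.mem j), DGMod.smul_sign,
      DGAlg.map_sign, rightExt_smul, hη, rightExt_apply, sgn_r]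
    simp

/-- The homotopy equation extends from `x = a y_j` to `x b`. Both terms contribute an expression in
`d b`, one with the sign involution applied after the homotopy and one with it applied before; these
cancel because the homotopy is odd, as `hη` demands. -/
lemma rightExt_homotopy {f : F.left →ₗ[k] F.left} (hfr : ∀ x b, f (F.r x b) = F.r (f x) b)
    (hη : ∀ j a, (B.deg j).negOnePow • η j (A.sgn a) = -F.left.sgn (η j a)) {j : B.J} {a : A}
    (h : F.left.d (η j a) + B.rightExt η (F.left.d (a • B.y j)) = f (a • B.y j)) (b : A) :
    F.left.d (B.rightExt η (F.r (a • B.y j) b)) + B.rightExt η (F.left.d (F.r (a • B.y j) b)) =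
      f (F.r (a • B.y j) b) := by
  rw [rightExt_apply, d_r', d_r', map_add, rightExt_r, rightExt_r, hfr, ← h,
    B.rightExt_sgn η hη, rightExt_smul]
  simp only [map_add, map_neg, LinearMap.add_apply, LinearMap.neg_apply]
  abel

/-- A right linear idempotent endomorphism with contractible image is null-homotopic by a right
linear homotopy. -/
theorem exists_homotopy (B : F.SemiBasis n) (f c : F.left →ₗ[k] F.left) (hfr : ∀ x b, f (F.r x b) = F.r (f x) b)
    (hfd : ∀ x, f (F.left.d x) = F.left.d (f x)) (hfs : ∀ x, f (F.left.sgn x) = F.left.sgn (f x))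
    (hff : ∀ x, f (f x) = f x) (hfc : ∀ x, f (c x) = c x)
    (hc : ∀ x, f x = x → F.left.d (c x) + c (F.left.d x) = x)
    (hcs : ∀ x, c (F.left.sgn x) = -F.left.sgn (c x)) :
    ∃ h : F.left →ₗ[k] F.left, (∀ x b, h (F.r x b) = F.r (h x) b) ∧
      (∀ x, h (F.left.sgn x) = -F.left.sgn (h x)) ∧
      ∀ x, F.left.d (h x) + h (F.left.d x) = f x := by
  classical
  have key : ∀ N : ℕ, ∃ η : B.J → A →ₗ[k] F.left, (∀ j a, f (η j a) = η j a) ∧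
      (∀ j a, (B.deg j).negOnePow • η j (A.sgn a) = -F.left.sgn (η j a)) ∧
      ∀ j, B.lev j < N → ∀ a,
        F.left.d (η j a) + B.rightExt η (F.left.d (a • B.y j)) = f (a • B.y j) := by
    intro N
    induction N with
    | zero => exact ⟨0, by simp, by simp, by simp⟩
    | succ N ih =>
      obtain ⟨η, hη, hηs, hηN⟩ := ih
      have hfη : ∀ x, f (B.rightExt η x) = B.rightExt η x := by
        intro x
        induction x using B.induction with
        | zero => simp
        | add x y hx hy => simp only [map_add, hx, hy]
        | r j a b => rw [rightExt_apply, hfr, hη]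
      have hhom : ∀ x ∈ B.levelSpan N,
          F.left.d (B.rightExt η x) + B.rightExt η (F.left.d x) = f x := by
        intro x hx
        refine LinearMap.eqOn_span (f := F.left.d ∘ₗ B.rightExt η + B.rightExt η ∘ₗ F.left.d)
          (g := f) ?_ hx
        rintro _ ⟨j, a, b, hj, rfl⟩
        exact B.rightExt_homotopy η hfr hηs (hηN j hj a) b
      -- Since `d (a y_j) = (d a) y_j + sgn(a) d y_j`, the equation for `η j` reads `d (η j a) + η j
      -- (d a) = u j a`, where `u j` involves only values of lower level when `B.lev j = N`. There
      -- `u j` is a chain map into the image of `f`, so `η j = c ∘ u j` solves the equation.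
      let u : B.J → A →ₗ[k] F.left := fun j =>
        f ∘ₗ (LinearMap.toSpanSingleton A F.left (B.y j)).restrictScalars k -
          B.rightExt η ∘ₗ
            (LinearMap.toSpanSingleton A F.left (F.left.d (B.y j))).restrictScalars k ∘ₗ A.sgn
      have hu : ∀ j a, u j a = f (a • B.y j) - B.rightExt η (A.sgn a • F.left.d (B.y j)) :=
        fun _ _ => rfl
      let η' : B.J → A →ₗ[k] F.left := fun j => if B.lev j = N then c ∘ₗ u j else η j
      have hη'1 : ∀ j, B.lev j = N → ∀ a, η' j a = c (u j a) := fun j hj a => by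
        simp only [η', if_pos hj]; rfl
      have hη'2 : ∀ j, B.lev j ≠ N → η' j = η j := fun j hj => by
        simp only [η', if_neg hj]
      have hlow : ∀ j, B.lev j ≤ N → ∀ a : A,
          B.rightExt η' (a • F.left.d (B.y j)) = B.rightExt η (a • F.left.d (B.y j)) := by
        intro j hj a
        exact B.rightExt_congr (N := B.lev j) (fun i hi => hη'2 i (by omega))
          (B.smul_mem_levelSpan a (B.d_mem j))
      refine ⟨η', fun j a => ?_, fun j a => ?_, fun j hj a => ?_⟩
      · by_cases hj : B.lev j = N
        · rw [hη'1 j hj, hfc]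
        · rw [hη'2 j hj, hη]
      · by_cases hj : B.lev j = N
        · rw [hη'1 j hj, hη'1 j hj, ← hcs, ← DGAlg.map_sign]
          congr 1
          rw [hu, hu, A.sgn_sgn, map_sub, ← hfs, DGMod.sgn_smul, DGMod.sgn_apply (B.mem j),
            DGMod.smul_sign, DGAlg.map_sign, smul_sub]
          congr 1
          have h1 := B.rightExt_sgn η hηs (A.sgn a • F.left.d (B.y j))
          rw [DGMod.sgn_smul, A.sgn_sgn, DGMod.sgn_apply (F.left.d_mem _ _ (B.mem j)),
            DGMod.smul_sign, DGAlg.map_sign, Int.negOnePow_succ, Units.neg_smul] at h1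
          exact neg_injective h1
        · rw [hη'2 j hj, hηs]
      · rw [DGMod.d_smul, map_add, rightExt_smul, hlow j (by omega)]
        by_cases hjN : B.lev j = N
        · have hfu : f (u j a) = u j a := by
            rw [hu, map_sub, hff, hfη]
          -- This is the homotopy equation, already known below level `N`, applied to `sgn(a) d
          -- y_j`.
          have hdu : F.left.d (u j a) = u j (A.d a) := by
            have h1 := hhom (A.sgn a • F.left.d (B.y j)) (B.smul_mem_levelSpan _ (by
              rw [← hjN]; exact B.d_mem j))
            rw [DGMod.d_smul, F.left.d_d, smul_zero, add_zero] at h1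
            rw [hu, hu, map_sub, ← hfd, DGMod.d_smul, map_add, ← h1, A.sgn_d, neg_smul, map_neg]
            abel
          have h2 := hc _ hfu
          rw [hdu] at h2
          rw [hη'1 j hjN, hη'1 j hjN, ← add_assoc, h2, hu]
          abel
        · have h1 := hηN j (by omega) a
          rw [DGMod.d_smul, map_add, rightExt_smul] at h1
          rw [hη'2 j hjN, h1]
  obtain ⟨η, hη, hηs, hηN⟩ := key (n + 1)
  refine ⟨B.rightExt η, B.rightExt_r η, B.rightExt_sgn η hηs, fun x => ?_⟩
  induction x using B.induction with
  | zero => simp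
  | add x y hx hy =>
    simp only [map_add, ← hx, ← hy]; abel
  | r j a b =>
    exact B.rightExt_homotopy η hfr hηs (hηN j (Nat.lt_succ_of_le (B.lev_le j)) a) b

end SemiBasis

end DGBimod

/-! ### The tensor product over `k` of a DG module and a complex -/

namespace DGMod

variable {k : Type u} [Field k] {A : DGAlg k} (N M : DGMod A)

/-- The homogeneous elements of degree `n` of `N ⊗ M`. -/
def tensorGr (n : ℤ) : Submodule k (N ⊗[k] M) :=
  Submodule.span k {x | ∃ (i j : ℤ) (a : N) (b : M), a ∈ N.gr i ∧ b ∈ M.gr j ∧ i + j = n ∧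
    x = a ⊗ₜ b}

variable {N M} in
lemma tmul_mem {i j n : ℤ} {a : N} {b : M} (ha : a ∈ N.gr i) (hb : b ∈ M.gr j) (h : i + j = n) :
    a ⊗ₜ b ∈ tensorGr N M n :=
  Submodule.subset_span ⟨i, j, a, b, ha, hb, h, rfl⟩

variable {N M} in
lemma tmul_induction {p : N ⊗[k] M → Prop} (x : N ⊗[k] M) (zero : p 0)
    (add : ∀ x y, p x → p y → p (x + y))
    (tmul : ∀ (i j : ℤ) (a : N) (b : M), a ∈ N.gr i → b ∈ M.gr j → p (a ⊗ₜ b)) : p x := by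
  induction x using TensorProduct.induction_on with
  | zero => exact zero
  | add x y hx hy => exact add x y hx hy
  | tmul a b =>
  induction a using Decomposition.inductionOn N.gr with
  | zero => rw [TensorProduct.zero_tmul]; exact zero
  | add a a' h h' => rw [TensorProduct.add_tmul]; exact add _ _ h h'
  | @homogeneous i a =>
  induction b using Decomposition.inductionOn M.gr with
  | zero => rw [TensorProduct.tmul_zero]; exact zero
  | add b b' h h' => rw [TensorProduct.tmul_add]; exact add _ _ h h'
  | @homogeneous j b => exact tmul i j a b a.2 b.2

/-- The map `N ⊗ M → ⨁ (N ⊗ M)^n` that splits a tensor into its homogeneous components. -/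
def tensorSplit : N ⊗[k] M →ₗ[k] ⨁ n, tensorGr N M n :=
  TensorProduct.lift
    ((DirectSum.toModule k ℤ ((⨁ j, M.gr j) →ₗ[k] ⨁ n, tensorGr N M n) fun i =>
      LinearMap.flip (DirectSum.toModule k ℤ (N.gr i →ₗ[k] ⨁ n, tensorGr N M n) fun j =>
        LinearMap.flip (LinearMap.mk₂ k
          (fun (a : N.gr i) (b : M.gr j) => DirectSum.lof k ℤ (fun n => tensorGr N M n) (i + j)
            ⟨(a : N) ⊗ₜ (b : M), tmul_mem a.2 b.2 rfl⟩)
          (fun a a' b => by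
            rw [← map_add]; congr 1; ext
            exact TensorProduct.add_tmul _ _ _)
          (fun c a b => by
            rw [← map_smul]; congr 1)
          (fun a b b' => by
            rw [← map_add]; congr 1; ext
            exact TensorProduct.tmul_add _ _ _)
          (fun c a b => by
            rw [← map_smul]; congr 1; ext
            exact TensorProduct.tmul_smul _ _ _)))).compl₁₂
      (decomposeLinearEquiv N.gr).toLinearMap (decomposeLinearEquiv M.gr).toLinearMap)

variable {N M} in
lemma tensorSplit_tmul {i j n : ℤ} {a : N} {b : M} (ha : a ∈ N.gr i) (hb : b ∈ M.gr j)
    (h : i + j = n) : tensorSplit N M (a ⊗ₜ b) =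
      DirectSum.lof k ℤ (fun n => tensorGr N M n) n ⟨a ⊗ₜ b, tmul_mem ha hb h⟩ := by
  subst h
  lift a to N.gr i using ha
  lift b to M.gr j using hb
  simp only [tensorSplit, LinearEquiv.coe_coe, TensorProduct.lift.tmul, LinearMap.compl₁₂_apply,
    decomposeLinearEquiv_apply_coe, DirectSum.toModule_lof, LinearMap.flip_apply,
    LinearMap.mk₂_apply]

instance : Decomposition (tensorGr N M) := Decomposition.ofLinearMap _ (tensorSplit N M)
    (by
      refine LinearMap.ext fun x => ?_
      induction x using tmul_induction with
      | zero => simp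
      | add x y hx hy => rw [map_add, map_add, hx, hy]
      | tmul i j a b ha hb =>
        rw [LinearMap.comp_apply, tensorSplit_tmul ha hb rfl, DirectSum.coeLinearMap_lof]
        rfl)
    (by
      ext n x : 2
      obtain ⟨x, hx⟩ := x
      simp only [LinearMap.comp_apply, DirectSum.coeLinearMap_lof, LinearMap.id_apply]
      induction hx using Submodule.span_induction with
      | zero => rw [map_zero]; exact (map_zero _).symm
      | add x y hx hy h h' => rw [map_add, h, h', ← map_add]; rfl
      | smul c x hx h => rw [map_smul, h, ← map_smul]; rfl
      | mem x hx =>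
        obtain ⟨i, j, a, b, ha, hb, h, rfl⟩ := hx
        exact tensorSplit_tmul ha hb h)

/-- The tensor product over `k` of a DG module and a complex. -/
def tensor : DGMod A where
  carrier := N ⊗[k] M
  gr := tensorGr N M
  smul_mem i j a x ha hx := by
    induction hx using Submodule.span_induction with
    | zero => rw [smul_zero]; exact zero_mem _
    | add x y hx hy h h' => rw [smul_add]; exact add_mem h h'
    | smul c x hx h => rw [smul_comm]; exact Submodule.smul_mem _ _ h
    | mem x hx =>
      obtain ⟨l, m, x, y, hx, hy, rfl, rfl⟩ := hx
      rw [TensorProduct.smul_tmul']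
      exact tmul_mem (N.smul_mem _ _ _ _ ha hx) hy (by ring)
  d := TensorProduct.map N.d LinearMap.id + TensorProduct.map N.sgn M.d
  d_mem n x hx := by
    induction hx using Submodule.span_induction with
    | zero => rw [map_zero]; exact zero_mem _
    | add x y hx hy h h' => rw [map_add]; exact add_mem h h'
    | smul c x hx h => rw [map_smul]; exact Submodule.smul_mem _ _ h
    | mem x hx =>
      obtain ⟨i, j, a, b, ha, hb, rfl, rfl⟩ := hx
      refine add_mem (tmul_mem (N.d_mem _ _ ha) hb (by ring))
        (tmul_mem (i := i) ?_ (M.d_mem _ _ hb) (by ring))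
      rw [sgn_apply ha]
      exact DGAlg.sign_mem _ _ ha
  d_d x := by
    induction x using TensorProduct.induction_on with
    | zero => simp
    | add x y h h' => rw [map_add, map_add, h, h', add_zero]
    | tmul a b => simp [N.d_d, M.d_d, sgn_d, TensorProduct.neg_tmul]
  leibniz i a x ha := by
    induction x using TensorProduct.induction_on with
    | zero => simp
    | add x y h h' => simp only [smul_add, map_add, h, h']; abel
    | tmul x y =>
      simp only [TensorProduct.smul_tmul', LinearMap.add_apply, TensorProduct.map_tmul,
        LinearMap.id_apply, d_smul, sgn_smul, A.sgn_apply ha, sign_smul, TensorProduct.add_tmul,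
        smul_add]
      rw [add_assoc]
      rcases Int.units_eq_one_or i.negOnePow with h | h <;> rw [h] <;>
        simp [TensorProduct.neg_tmul]

end DGMod

/-! ### The tensor product over `A` of a bimodule and a module -/

namespace DGBimod

variable {k : Type u} [Field k] {A : DGAlg k} (F : DGBimod A) (M : DGMod A)

/-- The element `f b ⊗ m - f ⊗ b m` of `F ⊗_k M`. -/
def relator (f : F.left) (b : A) (m : M) : F.left.tensor M :=
  (F.r f b ⊗ₜ[k] m - f ⊗ₜ[k] (b • m) : F.left ⊗[k] M)

/-- The homogeneous relators. -/
def relators : Set (F.left.tensor M) :=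
  {x | ∃ (i j l : ℤ) (f : F.left) (b : A) (m : M), f ∈ F.left.gr i ∧ b ∈ A.gr j ∧ m ∈ M.gr l ∧
    x = F.relator M f b m}

variable {F M} in
-- The relations are generated by homogeneous relators so that their span is visibly graded; by
-- trilinearity all relators then belong to it.
lemma relator_mem (f : F.left) (b : A) (m : M) :
    F.relator M f b m ∈ Submodule.span A (F.relators M) := by
  induction f using Decomposition.inductionOn F.left.gr with
  | zero =>
    convert zero_mem (Submodule.span A (F.relators M))
    simp [relator]
    rfl
  | add f f' h h' =>
    convert add_mem h h' using 1
    simp only [relator, map_add, LinearMap.add_apply, TensorProduct.add_tmul]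
    exact add_sub_add_comm _ _ _ _
  | @homogeneous i f =>
  induction b using Decomposition.inductionOn A.gr with
  | zero =>
    convert zero_mem (Submodule.span A (F.relators M))
    simp [relator]
    rfl
  | add f f' h h' =>
    convert add_mem h h' using 1
    simp only [relator, map_add, add_smul, TensorProduct.add_tmul, TensorProduct.tmul_add]
    exact add_sub_add_comm _ _ _ _
  | @homogeneous j b =>
  induction m using Decomposition.inductionOn M.gr with
  | zero =>
    convert zero_mem (Submodule.span A (F.relators M))
    simp [relator]
    rfl
  | add f f' h h' =>
    convert add_mem h h' using 1
    simp only [relator, smul_add, TensorProduct.tmul_add]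
    exact add_sub_add_comm _ _ _ _
  | @homogeneous l m => exact Submodule.subset_span ⟨i, j, l, f, b, m, f.2, b.2, m.2, rfl⟩

/-- The Leibniz rule turns the differential of a relator into a sum of relators, so the differential
passes to `F ⊗_A M`. -/
lemma d_relator (f : F.left) (b : A) (m : M) : (F.left.tensor M).d (F.relator M f b m) =
    F.relator M (F.left.d f) b m + F.relator M (F.left.sgn f) (A.d b) m +
      F.relator M (F.left.sgn f) (A.sgn b) (M.d m) := by
  have h : ∀ x : F.left ⊗[k] M, (F.left.tensor M).d x =
      (TensorProduct.map F.left.d LinearMap.id x + TensorProduct.map F.left.sgn M.d x :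
        F.left ⊗[k] M) := fun _ => rfl
  refine (h (F.r f b ⊗ₜ[k] m - f ⊗ₜ[k] (b • m) : F.left ⊗[k] M)).trans ?_
  change _ = ((_ - _ : F.left ⊗[k] M) + (_ - _ : F.left ⊗[k] M) + (_ - _ : F.left ⊗[k] M))
  simp only [map_sub, TensorProduct.map_tmul, LinearMap.id_apply, d_r', sgn_r,
    DGMod.d_smul, TensorProduct.add_tmul, TensorProduct.tmul_add]
  abel

/-- The relations of `F ⊗_A M`. -/
def relations : DGSubmodule (F.left.tensor M) :=
  (F.left.tensor M).spanHomogeneous (F.relators M)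
    (by
      rintro _ ⟨i, j, l, f, b, m, hf, hb, hm, rfl⟩
      exact ⟨i + j + l, sub_mem (DGMod.tmul_mem (F.r_mem _ _ _ _ hf hb) hm rfl)
        (DGMod.tmul_mem hf (M.smul_mem _ _ _ _ hb hm) (by ring))⟩)
    (by
      rintro _ ⟨i, j, l, f, b, m, hf, hb, hm, rfl⟩
      rw [d_relator]
      exact add_mem (add_mem (relator_mem _ _ _) (relator_mem _ _ _)) (relator_mem _ _ _))

/-- The DG module `F ⊗_A M`. -/
def tens : DGMod A := (F.relations M).quotient

/-- The tensor `f ⊗ m` in `F ⊗_A M`. -/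
def tm : F.left →ₗ[k] M →ₗ[k] F.tens M :=
  (TensorProduct.mk k F.left M).compr₂ ((F.relations M).proj.restrictScalars k)

variable {F M}

lemma tm_r (f : F.left) (b : A) (m : M) : F.tm M (F.r f b) m = F.tm M f (b • m) := by
  rw [← sub_eq_zero]
  refine (map_sub (F.relations M).proj _ _).symm.trans ?_
  exact (DGSubmodule.proj_eq_zero_iff _).2 (relator_mem f b m)

lemma smul_tm (a : A) (f : F.left) (m : M) : a • F.tm M f m = F.tm M (a • f) m := rfl

lemma tm_mem {i j : ℤ} {f : F.left} {m : M} (hf : f ∈ F.left.gr i) (hm : m ∈ M.gr j) :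
    F.tm M f m ∈ (F.tens M).gr (i + j) :=
  (DGSubmodule.mem_quotient_gr_iff _).2 ⟨_, DGMod.tmul_mem hf hm rfl, rfl⟩

lemma d_tm (f : F.left) (m : M) :
    (F.tens M).d (F.tm M f m) = F.tm M (F.left.d f) m + F.tm M (F.left.sgn f) (M.d m) := rfl

lemma tens_induction {p : F.tens M → Prop} (x : F.tens M) (zero : p 0)
    (add : ∀ x y, p x → p y → p (x + y)) (tm : ∀ f m, p (F.tm M f m)) : p x := by
  obtain ⟨x, rfl⟩ := (F.relations M).proj_surjective x
  have hx : p ((F.relations M).proj (show F.left ⊗[k] M from x)) := by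
    generalize (show F.left ⊗[k] M from x) = x
    induction x using TensorProduct.induction_on with
    | zero => exact zero
    | add x y hx hy => exact add _ _ hx hy
    | tmul f m => exact tm f m
  exact hx

/-- The linear map on `F ⊗_A M` defined by a balanced bilinear map. -/
def tensLift {W : Type u} [AddCommGroup W] [Module k W] (φ : F.left →ₗ[k] M →ₗ[k] W)
    (hφ : ∀ f b m, φ (F.r f b) m = φ f (b • m)) : F.tens M →ₗ[k] W :=
  ((F.relations M).toSub.restrictScalars k).liftQ (TensorProduct.lift φ) (by
    intro x hx
    have hx' : x ∈ Submodule.span A (F.relators M) := hx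
    change TensorProduct.lift φ x = 0
    clear hx
    induction hx' using Submodule.closure_induction with
    | zero => exact map_zero _
    | add x y _ _ hx hy => exact (map_add _ _ _).trans (by rw [hx, hy, add_zero])
    | smul_mem a x h =>
      obtain ⟨i, j, l, f, b, m, -, -, -, rfl⟩ := h
      change TensorProduct.lift φ (a • (F.r f b ⊗ₜ[k] m - f ⊗ₜ[k] (b • m))) = 0
      rw [smul_sub, TensorProduct.smul_tmul', TensorProduct.smul_tmul', map_sub,
        TensorProduct.lift.tmul, TensorProduct.lift.tmul, ← F.r_smul, hφ, sub_self])

lemma tensLift_tm {W : Type u} [AddCommGroup W] [Module k W] (φ : F.left →ₗ[k] M →ₗ[k] W)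
    (hφ : ∀ f b m, φ (F.r f b) m = φ f (b • m)) (f : F.left) (m : M) :
    tensLift φ hφ (F.tm M f m) = φ f m := rfl

namespace SemiBasis

variable {n : ℕ} (B : F.SemiBasis n)

/-- The bilinear map `(a y_j b, m) ↦ a ⊗ b m` with values in `⨁ A ⊗ M`. -/
def coordBilin (M : DGMod A) : F.left →ₗ[k] M →ₗ[k] (B.J →₀ A ⊗[k] M) :=
  (Finsupp.lsum k fun j => TensorProduct.lift (LinearMap.mk₂ k
    (fun a b : A => Finsupp.lsingle j ∘ₗ TensorProduct.mk k A M a ∘ₗ Algebra.lsmul k k M b)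
    (fun a a' b => by ext m : 1; simp)
    (fun c a b => by ext m : 1; simp [TensorProduct.smul_tmul'])
    (fun a b b' => by ext m : 1; simp [TensorProduct.tmul_add])
    (fun c a b => by ext m : 1; simp))) ∘ₗ B.equiv.symm.toLinearMap

lemma coordBilin_apply (j : B.J) (a b : A) (m : M) :
    B.coordBilin M (F.r (a • B.y j) b) m = Finsupp.single j (a ⊗ₜ (b • m)) := by
  rw [← B.equiv_single]
  simp [coordBilin]

/-- The `A`-linear map `F ⊗_A M → ⨁ A ⊗ M`. -/
def coord (M : DGMod A) : F.tens M →ₗ[A] (B.J →₀ A ⊗[k] M) :=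
  { tensLift (B.coordBilin M) (fun f b m => by
      induction f using B.induction with
      | zero => simp
      | add f g hf hg => simp only [map_add, LinearMap.add_apply, hf, hg]
      | r j a b' => rw [F.r_r, coordBilin_apply, coordBilin_apply, mul_smul]) with
    map_smul' := fun a x => by
      dsimp
      induction x using tens_induction with
      | zero => simp
      | add x y hx hy => rw [smul_add, map_add, map_add, hx, hy, smul_add]
      | tm f m =>
        rw [smul_tm, tensLift_tm, tensLift_tm]
        induction f using B.induction with
        | zero => simp
        | add f g hf hg => simp only [map_add, smul_add, LinearMap.add_apply, hf, hg]
        | r j a' b =>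
          rw [← F.r_smul, ← mul_smul, coordBilin_apply, coordBilin_apply, Finsupp.smul_single,
            TensorProduct.smul_tmul', smul_eq_mul] }

lemma coord_tm (j : B.J) (m : M) :
    B.coord M (F.tm M (B.y j) m) = Finsupp.single j (1 ⊗ₜ m) := by
  have := B.coordBilin_apply j 1 1 m
  rwa [F.r_one, one_smul, one_smul] at this

/-- The `A`-basis `y_j ⊗ m_i` of `F ⊗_A M`. -/
lemma exists_tens_basis {I : Type u} (b : Module.Basis I k M) :
    ∃ e : Module.Basis (B.J × I) A (F.tens M), ∀ p, e p = F.tm M (B.y p.1) (b p.2) := by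
  have li : LinearIndependent A (fun p : B.J × I => F.tm M (B.y p.1) (b p.2)) := by
    -- In coordinates `y_j ⊗ b_i` becomes `1 ⊗ b_i` in the `j`-th copy of `A ⊗_k M`, where base
    -- change of a `k`-basis gives an `A`-basis.
    refine LinearIndependent.of_comp (B.coord M) ?_
    have h := (Finsupp.basis fun _ : B.J =>
      Algebra.TensorProduct.basis A b).linearIndependent.comp (fun p : B.J × I => ⟨p.1, p.2⟩)
        (fun p q h => by
          obtain ⟨p1, p2⟩ := p
          obtain ⟨q1, q2⟩ := q
          simpa using h)
    convert h using 1
    ext1 p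
    simp [coord_tm]
  refine ⟨Module.Basis.mk li ?_, fun p => Module.Basis.mk_apply _ _ _⟩
  rintro x -
  induction x using tens_induction with
  | zero => exact zero_mem _
  | add x y hx hy => exact add_mem hx hy
  | tm f m =>
    induction f using B.induction with
    | zero => rw [map_zero]; exact zero_mem _
    | add f g hf hg => rw [map_add]; exact add_mem hf hg
    | r j a b' =>
      -- `a y_j b' ⊗ m = a (y_j ⊗ b' m)`, and `b' m` is expanded in the `k`-basis of `M`.
      rw [tm_r, ← smul_tm]
      refine Submodule.smul_mem _ _ ?_
      generalize b' • m = m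
      have hm : m ∈ Submodule.span k (Set.range b) := by rw [b.span_eq]; trivial
      induction hm using Submodule.span_induction with
      | zero => rw [map_zero]; exact zero_mem _
      | add x y _ _ hx hy => rw [map_add]; exact add_mem hx hy
      | smul c x _ hx => rw [map_smul]; exact Submodule.smul_of_tower_mem _ c hx
      | mem x hx =>
        obtain ⟨i, rfl⟩ := hx
        exact Submodule.subset_span ⟨(j, i), rfl⟩

/-- Tensoring with `m` does not raise the level: right coefficients are absorbed by `M`. This
carries the condition on `d y_j` from `F` to `F ⊗_A M`. -/
lemma tm_levelSpan {I : Type u} (b : Module.Basis I k M) {N : ℕ} {f : F.left}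
    (hf : f ∈ B.levelSpan N) (m : M) : F.tm M f m ∈ Submodule.span A
      ((fun p : B.J × I => F.tm M (B.y p.1) (b p.2)) '' {p | B.lev p.1 < N}) := by
  induction hf using Submodule.span_induction with
  | zero => rw [map_zero]; exact zero_mem _
  | add x y _ _ hx hy => rw [map_add]; exact add_mem hx hy
  | smul c x _ hx => rw [map_smul]; exact Submodule.smul_of_tower_mem _ c hx
  | mem x hx =>
    obtain ⟨j, a, b', hj, rfl⟩ := hx
    rw [tm_r, ← smul_tm]
    refine Submodule.smul_mem _ _ ?_
    generalize b' • m = m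
    have hm : m ∈ Submodule.span k (Set.range b) := by rw [b.span_eq]; trivial
    induction hm using Submodule.span_induction with
    | zero => rw [map_zero]; exact zero_mem _
    | add x y _ _ hx hy => rw [map_add]; exact add_mem hx hy
    | smul c x _ hx => rw [map_smul]; exact Submodule.smul_of_tower_mem _ c hx
    | mem x hx =>
      obtain ⟨i, rfl⟩ := hx
      exact Submodule.subset_span ⟨(j, i), hj, rfl⟩

end SemiBasis

end DGBimod

/-! ### Resolving `M` through `F ⊗_A M` -/

lemma apply_decompose {k V W : Type*} [Field k] [AddCommGroup V] [Module k V] [AddCommGroup W]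
    [Module k W] {gr : ℤ → Submodule k V} [Decomposition gr] {gr' : ℤ → Submodule k W}
    [Decomposition gr'] (f : V →ₗ[k] W) (hf : ∀ i, ∀ v ∈ gr i, f v ∈ gr' i) (i : ℤ) (v : V) :
    f (decompose gr v i) = (decompose gr' (f v) i : W) := by
  induction v using Decomposition.inductionOn gr with
  | zero => simp
  | add f g hf hg => simp only [decompose_add, map_add, DirectSum.add_apply, Submodule.coe_add,
      hf, hg]
  | @homogeneous l v =>
    by_cases hl : l = i
    · subst hl
      rw [decompose_of_mem_same _ v.2, decompose_of_mem_same _ (hf _ _ v.2)]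
    · rw [decompose_of_mem_ne _ v.2 hl, decompose_of_mem_ne _ (hf _ _ v.2) hl, map_zero]

namespace DGBimod

variable {k : Type u} [Field k] {A : DGAlg k} {F : DGBimod A} {n : ℕ}

/-- `F ⊗_A M` has a semi-free resolution with as many levels as `F`. -/
theorem SemiBasis.exists_resolution_tens (B : F.SemiBasis n) (M : DGMod A) :
    ∃ (G : DGMod A) (_ : G.SemiBasis n) (s : DGHom G (F.tens M)), s.IsQuasiIso := by
  obtain ⟨I, X, b, degI, degX, hI, hdI, hX, hdX⟩ := M.exists_split_basis
  obtain ⟨e, he⟩ := B.exists_tens_basis b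
  have he' : ⇑e = fun p : B.J × (I ⊕ X ⊕ X) => F.tm M (B.y p.1) (b p.2) := funext he
  -- The new basis replaces `y_j ⊗ d x` by `d (y_j ⊗ x) = d y_j ⊗ x + (-1)^|y_j| y_j ⊗ d x`. The
  -- first summand has lower level, so the change is triangular with the signs `ε`.
  let v : B.J × (I ⊕ X ⊕ X) → F.tens M := fun p =>
    Sum.elim (fun i => F.tm M (B.y p.1) (b (.inl i)))
      (Sum.elim (fun x => F.tm M (B.y p.1) (b (.inr (.inl x))))
        fun x => (F.tens M).d (F.tm M (B.y p.1) (b (.inr (.inl x))))) p.2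
  let ε : B.J × (I ⊕ X ⊕ X) → ℤˣ := fun p =>
    Sum.elim (fun _ => 1) (Sum.elim (fun _ => 1) fun _ => (B.deg p.1).negOnePow) p.2
  have htri : ∀ p, v p - ε p • e p ∈
      Submodule.span A (e '' {q | B.lev q.1 < B.lev p.1}) := by
    rintro ⟨j, i | x | x⟩
    · simp [v, ε, he]
    · simp [v, ε, he]
    · have h : v (j, .inr (.inr x)) - ε (j, .inr (.inr x)) • e (j, .inr (.inr x)) =
          F.tm M (F.left.d (B.y j)) (b (.inr (.inl x))) := by
        rw [he]
        change (F.tens M).d (F.tm M (B.y j) (b (.inr (.inl x)))) -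
          (B.deg j).negOnePow • F.tm M (B.y j) (b (.inr (.inr x))) = _
        rw [d_tm, hdX, DGMod.sgn_apply (B.mem j), DGAlg.map_sign]
        exact add_sub_cancel_right _ _
      rw [h, he']
      exact B.tm_levelSpan b (B.d_mem j) _
  obtain ⟨b', hb', hspan⟩ := exists_basis_of_triangular e (fun p => B.lev p.1) v ε htri
  let b'' := b'.reindex ((Equiv.prodSumDistrib B.J I (X ⊕ X)).trans
    (Equiv.sumCongr (Equiv.refl _) (Equiv.prodSumDistrib B.J X X)))
  have h1 : ∀ j i, b'' (.inl (j, i)) = F.tm M (B.y j) (b (.inl i)) := fun j i => by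
    simp only [b'', Module.Basis.reindex_apply, hb']; rfl
  have h2 : ∀ j x, b'' (.inr (.inl (j, x))) = F.tm M (B.y j) (b (.inr (.inl x))) := fun j i => by
    simp only [b'', Module.Basis.reindex_apply, hb']; rfl
  have h3 : ∀ j x, b'' (.inr (.inr (j, x))) =
      (F.tens M).d (F.tm M (B.y j) (b (.inr (.inl x)))) := fun j i => by
    simp only [b'', Module.Basis.reindex_apply, hb']; rfl
  refine DGMod.exists_quasiIso_of_pairs b'' (fun p => B.deg p.1 + degX p.2) ?_ ?_
    (fun p => B.deg p.1 + degI p.2) ?_ n (fun p => B.lev p.1) (fun p => B.lev_le p.1) ?_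
  · rintro ⟨j, x⟩
    rw [h2]
    exact tm_mem (B.mem j) (hX x)
  · rintro ⟨j, x⟩
    rw [h3, h2]
  · rintro ⟨j, i⟩
    rw [h1]
    exact tm_mem (B.mem j) (hI i)
  · rintro ⟨j, i⟩
    -- As `h_i` is a cocycle, `d (y_j ⊗ h_i) = d y_j ⊗ h_i` has lower level. Rewritten in the new
    -- basis, it involves only `y_l ⊗ h_i` of lower level and members of the pairs.
    rw [h1, d_tm, hdI, map_zero, add_zero]
    have h := B.tm_levelSpan b (B.d_mem j) (b (.inl i))
    rw [← he'] at h
    refine Submodule.span_le.2 ?_ (hspan _ h)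
    rintro _ ⟨⟨l, i | x | x⟩, hl, rfl⟩
    · exact Submodule.mem_sup_left (Submodule.subset_span ⟨(l, i), hl, h1 l i⟩)
    · exact Submodule.mem_sup_right (Submodule.subset_span ⟨.inl (l, x), h2 l x⟩)
    · exact Submodule.mem_sup_right (Submodule.subset_span ⟨.inr (l, x), h3 l x⟩)

/-- A resolution `ε : F → A` of bimodules with a cocycle `s` over `1` induces a
quasi-isomorphism `F ⊗_A M → M`. -/
theorem SemiBasis.exists_quasiIso_tens (B : F.SemiBasis n) (M : DGMod A) (ε : F.left →ₗ[A] A)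
    (hεr : ∀ f b, ε (F.r f b) = ε f * b) (hεd : ∀ f, ε (F.left.d f) = A.d (ε f))
    (hεg : ∀ i, ∀ f ∈ F.left.gr i, ε f ∈ A.gr i)
    (hinj : ∀ f, F.left.d f = 0 → ε f = 0 → ∃ f', F.left.d f' = f)
    (s : F.left) (hs0 : s ∈ F.left.gr 0) (hds : F.left.d s = 0) (hs : ε s = 1) :
    ∃ g : DGHom (F.tens M) M, g.IsQuasiIso := by
  have hss : F.left.sgn s = s := by rw [DGMod.sgn_apply hs0]; simp
  have hdr : ∀ a, F.left.d (F.r s a) = F.r s (A.d a) := fun a => by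
    rw [d_r', hds, hss, map_zero, LinearMap.zero_apply, zero_add]
  have hεs : ∀ f, ε (F.left.sgn f) = A.sgn (ε f) := by
    intro f
    induction f using Decomposition.inductionOn F.left.gr with
    | zero => simp
    | add f g hf hg => simp only [map_add, hf, hg]
    | @homogeneous i f =>
      rw [DGMod.sgn_apply f.2, A.sgn_apply (hεg i f f.2)]
      exact DGAlg.map_sign (ε.restrictScalars k) _ _
  -- `π` projects onto `ker ε`. It is right linear and commutes with `d` because `s` is a cocycle of
  -- degree `0` with `ε s = 1`.
  let π : F.left →ₗ[k] F.left := LinearMap.id - F.r s ∘ₗ ε.restrictScalars k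
  have hπ : ∀ f, π f = f - F.r s (ε f) := fun _ => rfl
  have hεπ : ∀ f, ε (π f) = 0 := fun f => by rw [hπ, map_sub, hεr, hs, one_mul, sub_self]
  have hπK : ∀ f, ε f = 0 → π f = f := fun f hf => by rw [hπ, hf, map_zero, sub_zero]
  let K : DGSubmodule F.left :=
    { toSub := LinearMap.ker ε
      homogeneous := fun i f hf => by
        rw [LinearMap.mem_ker] at hf ⊢
        refine (apply_decompose (gr' := A.gr) (ε.restrictScalars k) hεg i f).trans ?_
        rw [LinearMap.restrictScalars_apply, hf]
        simp
      d_mem := fun f hf => by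
        rw [LinearMap.mem_ker] at hf ⊢
        rw [hεd, hf, map_zero] }
  have hKmem : ∀ x : K.toDGMod, ε (K.emb x) = 0 := fun x => K.emb_mem x
  -- `ker ε` is acyclic: if `x` in it equals `d w` with `w` in `F`, then also `x = d (π w)`, and `π
  -- w` lies in `ker ε`.
  obtain ⟨c, hc, hcs⟩ := DGMod.exists_contraction (M := K.toDGMod) fun x hx => by
    obtain ⟨w, hw⟩ := hinj (K.emb x) (by rw [← K.emb_d, hx, map_zero]) (hKmem x)
    obtain ⟨w', hw'⟩ := K.exists_emb (m := π w) (hεπ w)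
    refine ⟨w', K.emb_injective ?_⟩
    rw [K.emb_d, hw', hπ, map_sub, hdr, ← hεd, hw, hKmem, map_zero, sub_zero]
  let p : F.left →ₗ[k] K.toDGMod :=
    { toFun := fun f => ⟨π f, hεπ f⟩
      map_add' := fun f g => K.emb_injective (map_add π f g)
      map_smul' := fun a f => K.emb_injective (map_smul π a f) }
  have hp : ∀ f, K.emb (p f) = π f := fun _ => rfl
  have hπd : ∀ f, π (F.left.d f) = F.left.d (π f) := fun f => by
    rw [hπ, hπ, map_sub, hdr, hεd]
  have hπs : ∀ f, π (F.left.sgn f) = F.left.sgn (π f) := fun f => by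
    rw [hπ, hπ, map_sub, sgn_r, hss, hεs]
  have hKs : ∀ x : K.toDGMod, K.emb (K.toDGMod.sgn x) = F.left.sgn (K.emb x) := by
    intro x
    induction x using Decomposition.inductionOn K.toDGMod.gr with
    | zero => simp
    | add f g hf hg => simp only [map_add, hf, hg]
    | @homogeneous i x =>
      rw [DGMod.sgn_apply x.2, DGMod.sgn_apply (K.mem_toDGMod_gr_iff.1 x.2)]
      exact DGAlg.map_sign (K.emb.restrictScalars k) _ _
  have hpd : ∀ f, p (F.left.d f) = K.toDGMod.d (p f) := fun f =>
    K.emb_injective (by rw [hp, K.emb_d, hp, hπd])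
  have hps : ∀ f, p (F.left.sgn f) = K.toDGMod.sgn (p f) := fun f =>
    K.emb_injective (by rw [hp, hKs, hp, hπs])
  -- The contraction `c` is only `k`-linear and would not survive tensoring over `A`; semi-freeness
  -- of `F` supplies a right linear homotopy.
  obtain ⟨h, hr, hhs, hh⟩ := B.exists_homotopy π (K.emb.restrictScalars k ∘ₗ c ∘ₗ p)
    (fun x b => by rw [hπ, hπ, hεr, map_sub, LinearMap.sub_apply, F.r_r])
    hπd hπs (fun x => hπK _ (hεπ x)) (fun x => hπK _ (hKmem _))
    (fun x hx => by
      change F.left.d (K.emb (c (p x))) + K.emb (c (p (F.left.d x))) = x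
      rw [hpd, ← K.emb_d, ← map_add, hc, hp, hx])
    (fun x => by
      change K.emb (c (p (F.left.sgn x))) = -F.left.sgn (K.emb (c (p x)))
      rw [hps, hcs, map_neg, hKs])
  let φ : F.left →ₗ[k] M →ₗ[k] M :=
    (Algebra.lsmul k k M).toLinearMap ∘ₗ ε.restrictScalars k
  have hφ : ∀ f m, φ f m = ε f • m := fun _ _ => rfl
  let gk : F.tens M →ₗ[k] M := tensLift φ fun f b m => by rw [hφ, hφ, hεr, mul_smul]
  have hgk : ∀ f m, gk (F.tm M f m) = ε f • m := fun _ _ => rfl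
  let g : DGHom (F.tens M) M :=
    { toLin :=
        { gk with
          map_smul' := fun a x => by
            dsimp
            induction x using tens_induction with
            | zero => simp
            | add x y hx hy => rw [smul_add, map_add, map_add, hx, hy, smul_add]
            | tm f m => rw [smul_tm, hgk, hgk, map_smul, smul_eq_mul, mul_smul] }
      map_mem := fun i x hx => by
        change gk x ∈ M.gr i
        obtain ⟨y, hy, rfl⟩ := (DGSubmodule.mem_quotient_gr_iff _).1 hx
        refine Submodule.span_le (p := (M.gr i).comap
          (gk ∘ₗ (F.relations M).proj.restrictScalars k)).2 ?_ hy
        rintro _ ⟨i, j, f, m, hf, hm, rfl, rfl⟩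
        exact M.smul_mem _ _ _ _ (hεg _ _ hf) hm
      comm := fun x => by
        change gk ((F.tens M).d x) = M.d (gk x)
        induction x using tens_induction with
        | zero => simp
        | add x y hx hy => simp only [map_add, hx, hy]
        | tm f m => rw [d_tm, map_add, hgk, hgk, hgk, DGMod.d_smul, hεd, hεs] }
  have hg : ∀ x, g.toLin x = gk x := fun _ => rfl
  -- The inverse is `m ↦ s ⊗ m` and the homotopy is `f ⊗ m ↦ h f ⊗ m`, which is balanced by right
  -- linearity. It works because `π f ⊗ m = f ⊗ m - s ⊗ ε(f) m`.
  refine ⟨g, .of_rightInverse (F.tm M s) (fun m => ?_)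
    (tensLift (F.tm M ∘ₗ h) fun f b m => ?_) (fun m => ?_) fun x => ?_⟩
  · rw [d_tm, hds, hss, map_zero, LinearMap.zero_apply, zero_add]
  · rw [LinearMap.comp_apply, LinearMap.comp_apply, hr, tm_r]
  · rw [hg, hgk, hs, one_smul]
  · induction x using tens_induction with
    | zero => simp
    | add x y hx hy =>
      simp only [map_add] at hx hy ⊢
      rw [add_add_add_comm, hx, hy]; abel
    | tm f m =>
      rw [tensLift_tm, d_tm, map_add, tensLift_tm, tensLift_tm, hg, hgk]
      simp only [LinearMap.comp_apply]
      rw [d_tm, hhs, ← tm_r, eq_sub_of_add_eq (hh f), hπ]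
      simp only [map_sub, map_neg, LinearMap.sub_apply, LinearMap.neg_apply]
      abel

end DGBimod

/-! ### The augmentation of a resolution of `A` and the main theorem -/

namespace DGMod

variable {k : Type u} [Field k] {A : DGAlg k}

variable (A) in
/-- The identity map of the underlying spaces, from `A` to `A` as a DG `A^e`-module. -/
def toSelfEnv : A ≃ₗ[k] A.selfEnv := LinearEquiv.refl k A.carrier

lemma selfEnv_smul_left (a c : A) : A.envTmul a 1 • toSelfEnv A c = toSelfEnv A (a * c) := by
  change a * A.opMul 1 c = a * c
  rw [A.one_opMul]

lemma selfEnv_smul_right {i j : ℤ} {b c : A} (hb : b ∈ A.gr j) (hc : c ∈ A.gr i) :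
    A.envTmul 1 b • toSelfEnv A c = toSelfEnv A ((j * i).negOnePow • (c * b)) := by
  change 1 * A.opMul b c = (j * i).negOnePow • (c * b)
  rw [DGAlg.opMul_apply A hb hc, one_mul]

lemma toLin_rightOfEnv {F : DGMod A.env} (f : DGHom F A.selfEnv) (x : F) (b : A) :
    f.toLin (F.rightOfEnv b x) = toSelfEnv A ((toSelfEnv A).symm (f.toLin x) * b) := by
  induction x using Decomposition.inductionOn F.gr with
  | zero => simp
  | add x y hx hy => simp only [map_add, add_mul, hx, hy]
  | @homogeneous i x =>
  induction b using Decomposition.inductionOn A.gr with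
  | zero => simp
  | add x y hx hy => simp only [map_add, mul_add, LinearMap.add_apply, hx, hy]
  | @homogeneous j b =>
    have h1 : A.envTmul 1 (b : A) • f.toLin x =
        toSelfEnv A ((j * i).negOnePow • ((toSelfEnv A).symm (f.toLin x) * b)) := by
      rw [← selfEnv_smul_right (c := (toSelfEnv A).symm (f.toLin x)) b.2 (f.map_mem i _ x.2),
        LinearEquiv.apply_symm_apply]
    have h2 := DGAlg.map_sign (toSelfEnv A).toLinearMap (j * i)
      ((toSelfEnv A).symm (f.toLin x) * b)
    rw [LinearEquiv.coe_coe] at h2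
    rw [F.rightOfEnv_apply x.2 b.2]
    refine (DGAlg.map_sign (f.toLin.restrictScalars k) _ _).trans ?_
    rw [LinearMap.restrictScalars_apply, map_smul, h1, h2, smul_smul, ← Int.negOnePow_add,
      Int.negOnePow_even _ ⟨j * i, by ring⟩, one_smul]

/-- The bimodule map defined by a morphism `F → A` of DG `A^e`-modules. -/
def augmentation {F : DGMod A.env} (f : DGHom F A.selfEnv) : F.bimodOfEnv.left →ₗ[A] A where
  toFun x := (toSelfEnv A).symm (f.toLin x)
  map_add' := (((toSelfEnv A).symm.toLinearMap ∘ₗ f.toLin.restrictScalars k).map_add)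
  map_smul' a x := by
    have h : ∀ x : F, f.toLin (A.envTmul a 1 • x) = toSelfEnv A
        (a * (toSelfEnv A).symm (f.toLin x)) := fun x => by
      rw [← selfEnv_smul_left, map_smul, LinearEquiv.apply_symm_apply]
    exact congrArg (toSelfEnv A).symm (h x)

lemma augmentation_r {F : DGMod A.env} (f : DGHom F A.selfEnv) (x : F.bimodOfEnv.left) (b : A) :
    augmentation f (F.bimodOfEnv.r x b) = augmentation f x * b :=
  congrArg (toSelfEnv A).symm (toLin_rightOfEnv f x b)

/-- The semi-free replacement of `F ⊗_A M`, followed by `F ⊗_A M → M`, is a resolution of `M` with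
the levels of `F`. Connectedness provides the strict lift `s` of `1` and the nontriviality of `A`.
-/
theorem coneLength_le_of_resolution (hA : A.IsConnected) {F : DGMod A.env}
    {f : DGHom F A.selfEnv} (hf : f.IsQuasiIso) (φ : F.SemiFreeFiltration) {n : ℕ}
    (hn : (φ.fil (n + 1)).toSub = ⊤) (M : DGMod A) : M.coneLength ≤ n := by
  obtain ⟨B⟩ := exists_semiBasis φ hn
  have : Nontrivial A := hA.2.1.nontrivial
  obtain ⟨s, a, hs, hsa⟩ := hf.surjective (n := toSelfEnv A 1) A.d_one
  -- A priori `f s = 1 + d a`. In degree `0` the error is the differential of the component of `a`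
  -- in `A^{-1} = 0`, so the degree `0` part of `s` maps to `1` exactly.
  have hs0 : f.toLin (decompose F.gr s 0 : F) = toSelfEnv A 1 := by
    have h1 := apply_decompose (gr := F.gr) (gr' := A.selfEnv.gr) (f.toLin.restrictScalars k)
      f.map_mem 0 s
    have h2 : (decompose A.selfEnv.gr (toSelfEnv A 1) 0 : A.selfEnv) = toSelfEnv A 1 :=
      decompose_of_mem_same (ℳ := A.selfEnv.gr) (SetLike.one_mem_graded A.gr)
    have h3 : (decompose A.selfEnv.gr a (-1) : A.selfEnv) = 0 := by
      rw [← Submodule.mem_bot k, ← show A.selfEnv.gr (-1) = ⊥ from hA.1 (-1) (by norm_num)]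
      exact (decompose A.selfEnv.gr a (-1)).2
    have h4 := decompose_d_apply (-1) a
    rw [h3, map_zero, neg_add_cancel] at h4
    refine h1.trans ?_
    change (decompose A.selfEnv.gr (f.toLin s) 0 : A.selfEnv) = _
    rw [hsa, decompose_add, DirectSum.add_apply, Submodule.coe_add, h2, h4, add_zero]
  have hds : F.d (decompose F.gr s 0) = 0 := by
    rw [← decompose_d_apply 0 s, hs]
    simp
  obtain ⟨g, hg⟩ := B.toBimod.exists_quasiIso_tens M (augmentation f) (augmentation_r f) f.comm
    f.map_mem (fun x hx hx' => hf.injective hx (n := 0) (by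
      rw [map_zero]; exact hx'.symm))
    (decompose F.gr s 0 : F) (decompose F.gr s 0).2 hds hs0
  obtain ⟨G, BG, t, ht⟩ := B.toBimod.exists_resolution_tens M
  exact BG.coneLength_le (hg.comp ht)

end DGMod

end

theorem mainTheorem8 {k : Type u} [Field k] (A : DGAlg k) (hA : A.IsConnected) :
    (A.selfEnv.coneLength < ⊤ →
      ∀ M : DGMod A, M.coneLength ≤ A.selfEnv.coneLength) ∧
    A.leftGlobalDim ≤ A.selfEnv.coneLength := by
  -- The cone length of `A` over `A^e` is an infimum over resolutions and filtrations, so it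
  -- suffices to bound the cone length of `M` by the length of each one.
  have key : ∀ M : DGMod A, M.coneLength ≤ A.selfEnv.coneLength := fun M =>
    le_iInf₂ fun F _ => le_iInf fun ⟨_, hf⟩ => le_iInf₂ fun _ ⟨φ, _, hn⟩ =>
      DGMod.coneLength_le_of_resolution hA hf φ hn.1 M
  exact ⟨fun _ => key, iSup_le key⟩
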